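/- Let $\|\cdot\|$ be any norm on $\mathbb{R}^d$, $S=\{v\in\mathbb{R}^d:\|v\|=1\}$ its unit sphere, $\alpha$ a finite Borel measure on $S$ and $\beta:S\to[0,\infty)$ Borel measurable. Let $\mu$ be a $\Gamma_d(\alpha,\beta)$ distribution, i.e. an infinitely divisible probability distribution on $\mathbb{R}^d$ such that, for all $z\in\mathbb{R}^d$, $$\hat\mu(z)=\int_{\mathbb{R}^d}e^{iz^\top x}\,\mu(\mathrm{d}x)=\exp\left(\int_S\int_0^\infty\left(e^{irv^\top z}-1\right)\frac{e^{-\beta(v)r}}{r}\,\mathrm{d}r\,\alpha(\mathrm{d}v)\right),$$ where the double integral converges absolutely. For $z\in\mathbb{C}^d$ write $v^\top z=\sum_j v_jz_j$; the Fourier–Laplace transform $\hat\mu(z)=\int_{\mathbb{R}^d}e^{ix^\top z}\,\mu(\mathrm{d}x)$ is said to exist at $z$ if this integral converges absolutely. (i) If there is $\kappa>0$ with $\beta(v)\ge\kappa$ for $\alpha$-almost every $v\in S$, then there is an open neighbourhood $U\subseteq\mathbb{C}^d$ of $0$ such that $\hat\mu(z)$ exists for all $z\in U$, $\hat\mu$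 is analytic on $U$, and $$\hat\mu(z)=\exp\left(\int_S\ln\left(\frac{\beta(v)}{\beta(v)-iv^\top z}\right)\alpha(\mathrm{d}v)\right)\qquad\text{for all }z\in U,$$ where $\ln$ is the main branch of the complex logarithm; here, for every $z\in U$, the argument of $\ln$ is defined and lies in $\mathbb{C}\setminus(-\infty,0]$ for $\alpha$-almost every $v$, and the integral converges absolutely. (ii) If there is a sequence $(v_n)_{n\in\mathbb{N}}$ in $S$ with $\lim_{n\to\infty}\beta(v_n)=0$ and $\alpha(\{v_n\})>0$ for all $n\in\mathbb{N}$, then there is no neighbourhood $U\subseteq\mathbb{C}^d$ of $0$ such that $\hat\mu(z)$ exists for all $z\in U$. -/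

import Mathlib

open MeasureTheory Filter Topology
open scoped NNReal ENNReal

/-- The `n`-fold convolution power of a measure on `ℝ^d`. -/
noncomputable def convPow {d : ℕ} (ν : Measure (EuclideanSpace ℝ (Fin d))) :
    ℕ → Measure (EuclideanSpace ℝ (Fin d))
  | 0 => Measure.dirac 0
  | n + 1 => (convPow ν n).conv ν

/-- Infinite divisibility of a probability distribution on `ℝ^d`. -/
def IsInfinitelyDivisible {d : ℕ} (μ : Measure (EuclideanSpace ℝ (Fin d))) : Prop :=
  ∀ n : ℕ, 0 < n → ∃ ν : Measure (EuclideanSpace ℝ (Fin d)),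
    IsProbabilityMeasure ν ∧ convPow ν n = μ

/-- The unit sphere of `ℝ^d` with respect to the norm `N`. -/
def unitSphere {d : ℕ} (N : Seminorm ℝ (EuclideanSpace ℝ (Fin d))) :
    Set (EuclideanSpace ℝ (Fin d)) :=
  {v | N v = 1}

/-- The bilinear (not sesquilinear) product `xᵀ z` of `x ∈ ℝ^d` and `z ∈ ℂ^d`. -/
noncomputable def bilinPair {d : ℕ} (x : EuclideanSpace ℝ (Fin d))
    (z : EuclideanSpace ℂ (Fin d)) : ℂ :=
  ∑ j, (x j : ℂ) * z j

/-- The Fourier-Laplace transform of `μ` exists at `z ∈ ℂ^d`: the defining integral converges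
(absolutely, as a Lebesgue integral). -/
def FourierLaplaceExistsAt {d : ℕ} (μ : Measure (EuclideanSpace ℝ (Fin d)))
    (z : EuclideanSpace ℂ (Fin d)) : Prop :=
  Integrable (fun x => Complex.exp (Complex.I * bilinPair x z)) μ

/-- The Fourier-Laplace transform `μ̂(z) = ∫ exp(i xᵀ z) μ(dx)`, `z ∈ ℂ^d`. -/
noncomputable def fourierLaplace {d : ℕ} (μ : Measure (EuclideanSpace ℝ (Fin d)))
    (z : EuclideanSpace ℂ (Fin d)) : ℂ :=
  ∫ x, Complex.exp (Complex.I * bilinPair x z) ∂μ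

/-- The integrand `(exp(i r vᵀ z) - 1) exp(-b r) / r` in the exponent of the characteristic
function of a `d`-dimensional Gamma distribution, where `b = β(v)`. -/
noncomputable def gammaExponentIntegrand {d : ℕ} (z v : EuclideanSpace ℝ (Fin d)) (b r : ℝ) : ℂ :=
  (Complex.exp (Complex.I * ((r * inner ℝ v z : ℝ) : ℂ)) - 1) * ((Real.exp (-(b * r)) / r : ℝ) : ℂ)

/-- `μ` is the `Γ_d(α, β)` distribution with respect to the norm `N`: an infinitely divisible
probability measure with
`μ̂(z) = exp (∫_S ∫_{(0,∞)} (exp(i r vᵀ z) - 1) exp(-β(v) r) / r dr α(dv))` for all `z ∈ ℝ^d`.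
The field `integrable_exponent` says that this double integral exists. -/
structure IsMultivariateGamma {d : ℕ} (N : Seminorm ℝ (EuclideanSpace ℝ (Fin d)))
    (α : Measure (unitSphere N)) (β : unitSphere N → ℝ≥0)
    (μ : Measure (EuclideanSpace ℝ (Fin d))) : Prop where
  isProbabilityMeasure : IsProbabilityMeasure μ
  isInfinitelyDivisible : IsInfinitelyDivisible μ
  integrable_exponent : ∀ z : EuclideanSpace ℝ (Fin d),
    Integrable (fun p : unitSphere N × ℝ => gammaExponentIntegrand z p.1 (β p.1) p.2)
      (α.prod (volume.restrict (Set.Ioi 0)))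
  charFun_eq : ∀ z : EuclideanSpace ℝ (Fin d),
    charFun μ z =
      Complex.exp (∫ v : unitSphere N,
        (∫ r in Set.Ioi (0 : ℝ), gammaExponentIntegrand z v (β v) r) ∂α)

/-- The quotient `β(v) / (β(v) - i vᵀ z)`, with `b = β(v)`. -/
noncomputable def gammaQuotient {d : ℕ} (z : EuclideanSpace ℂ (Fin d))
    (v : EuclideanSpace ℝ (Fin d)) (b : ℝ) : ℂ :=
  (b : ℂ) / ((b : ℂ) - Complex.I * bilinPair v z)

/-- At real arguments the Fourier-Laplace transform is the characteristic function. -/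
theorem fourierLaplace_ofReal {d : ℕ} (μ : Measure (EuclideanSpace ℝ (Fin d)))
    (z : EuclideanSpace ℝ (Fin d)) :
    fourierLaplace μ (WithLp.toLp 2 (fun j => (z j : ℂ))) = charFun μ z := by
  simp only [fourierLaplace, charFun_apply, bilinPair, PiLp.inner_apply]
  congr 1
  ext x
  congr 1
  rw [mul_comm]
  congr 1
  push_cast
  refine Finset.sum_congr rfl fun j _ => ?_
  simp [mul_comm]

/-! Both parts turn information about transforms into finiteness of integrals of `cosh - 1`. The
bridge is the family `coshApprox n h`: expand `cosh x - 1` in powers of `x ^ 2`, truncate, and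
replace `x ^ 2` by `(2 - 2 cos (h x)) / h ^ 2`. These functions are cosine polynomials vanishing at
`0`, lie between `0` and `cosh - 1`, and converge to it, so by Fatou a uniform bound on their
integrals suffices (`lintegral_cosh_sub_one_le`).

Part (i). The Frullani integral gives `charFun μ = exp (logIntegral)` on `ℝ^d`. On a tube `‖Im z‖ <
R` the denominators `1 - i vᵀz / β(v)` have real part at least `1/2`, so the right side is
holomorphic along complex lines and bounded by `2 ^ α(S)`. Cauchy estimates on a strip bound
symmetric differences of the one-dimensional characteristic functions, hence the integrals of powers
of `cosQuadratic`; these sum to an exponential moment of each coordinate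
(`integrable_cosh_of_charFun`). Exponential moments yield existence and a power series for `μ̂` near
`0`. The identity theorem on the line `s ↦ Re z + s Im z`, evaluated at `s = i`, extends the formula
from real to complex arguments.

Part (ii). If `μ̂` existed near `0`, then `exp ⟨x, ±a⟩` would be `μ`-integrable for small `a`. Write
`μ` as the `(m + 1)`-fold convolution power of `ν`, and let `σ_m` be the law of `⟨X - X', a⟩` with
`X, X'` independent of law `ν`. As `m → ∞`, `(m + 1) σ_m` converges, tested on cosine polynomials,
to twice the projected Lévy measure. Since `(∫ cosh dσ_m) ^ (m + 1)` does not depend on `m`,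
Bernoulli's inequality makes `cosh - 1` integrable against that Lévy measure
(`lintegral_cosh_sub_one_lt_top`). An atom `v` of `α` with `0 < ⟨v, a⟩` and `β(v) ≤ ⟨v, a⟩` makes
that integral infinite. Choosing `a` parallel to `v_n` with `β(v_n)` small gives the contradiction.
-/

/-! ### Approximation of `cosh - 1` by cosine polynomials -/

/-- A bound on the integrals of nonnegative functions passes to the pointwise limit. -/
theorem lintegral_le_of_tendsto_of_le {Ω : Type*} [MeasurableSpace Ω] {η : Measure Ω}
    {f : ℕ → Ω → ℝ} {g : Ω → ℝ} {C : ℝ≥0∞} (hf : ∀ n, Measurable (f n))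
    (hlim : ∀ x, Tendsto (fun n => f n x) atTop (𝓝 (g x)))
    (hC : ∀ n, ∫⁻ x, ENNReal.ofReal (f n x) ∂η ≤ C) :
    ∫⁻ x, ENNReal.ofReal (g x) ∂η ≤ C := by
  have h1 : ∀ x, liminf (fun n => ENNReal.ofReal (f n x)) atTop = ENNReal.ofReal (g x) :=
    fun x => (ENNReal.tendsto_ofReal (hlim x)).liminf_eq
  calc ∫⁻ x, ENNReal.ofReal (g x) ∂η
      = ∫⁻ x, liminf (fun n => ENNReal.ofReal (f n x)) atTop ∂η := by simp_rw [h1]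
    _ ≤ liminf (fun n => ∫⁻ x, ENNReal.ofReal (f n x) ∂η) atTop :=
        lintegral_liminf_le fun n => (hf n).ennreal_ofReal
    _ ≤ C := by
        refine (liminf_le_liminf (Eventually.of_forall hC)).trans ?_
        simp

/-- Real trigonometric polynomials in cosines that vanish at the origin. -/
noncomputable def cosPoly : Submodule ℝ (ℝ → ℝ) :=
  Submodule.span ℝ (Set.range fun t x : ℝ => Real.cos (t * x) - 1)

theorem cos_sub_one_mem_cosPoly (t : ℝ) : (fun x : ℝ => Real.cos (t * x) - 1) ∈ cosPoly :=
  Submodule.subset_span ⟨t, rfl⟩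

/-- Product-to-sum formula; the constants left over regroup so that every cosine is again paired
with a `-1`. -/
theorem mul_mem_cosPoly {f g : ℝ → ℝ} (hf : f ∈ cosPoly) (hg : g ∈ cosPoly) :
    f * g ∈ cosPoly := by
  have key : cosPoly * cosPoly ≤ cosPoly := by
    rw [cosPoly, Submodule.span_mul_span, Submodule.span_le]
    rintro _ ⟨_, ⟨t, rfl⟩, _, ⟨u, rfl⟩, rfl⟩
    have : ((fun x : ℝ => Real.cos (t * x) - 1) * fun x : ℝ => Real.cos (u * x) - 1)
        = (1 / 2 : ℝ) • (fun x : ℝ => Real.cos ((t + u) * x) - 1)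
          + (1 / 2 : ℝ) • (fun x : ℝ => Real.cos ((t - u) * x) - 1)
          - (fun x : ℝ => Real.cos (t * x) - 1) - (fun x : ℝ => Real.cos (u * x) - 1) := by
      ext x
      simp only [Pi.mul_apply, Pi.add_apply, Pi.sub_apply, Pi.smul_apply, smul_eq_mul, add_mul,
        sub_mul, Real.cos_add, Real.cos_sub]
      ring
    change _ ∈ cosPoly
    dsimp only
    rw [this]
    exact cosPoly.sub_mem (cosPoly.sub_mem (cosPoly.add_mem
      (cosPoly.smul_mem _ (cos_sub_one_mem_cosPoly _))
      (cosPoly.smul_mem _ (cos_sub_one_mem_cosPoly _)))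
      (cos_sub_one_mem_cosPoly _)) (cos_sub_one_mem_cosPoly _)
  exact key (Submodule.mul_mem_mul hf hg)

theorem continuous_of_mem_cosPoly {g : ℝ → ℝ} (hg : g ∈ cosPoly) : Continuous g := by
  induction hg using Submodule.span_induction with
  | mem x h => obtain ⟨t, rfl⟩ := h; fun_prop
  | zero => exact continuous_const
  | add x y _ _ hx hy => exact hx.add hy
  | smul a x _ hx => exact hx.const_smul a

/-- The rescaled second difference `(2 - 2 cos (h x)) / h ^ 2`, an approximation of `x ^ 2`. -/
noncomputable def cosQuadratic (h x : ℝ) : ℝ := (2 - 2 * Real.cos (h * x)) / h ^ 2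

theorem cosQuadratic_nonneg (h x : ℝ) : 0 ≤ cosQuadratic h x :=
  div_nonneg (by linarith [Real.cos_le_one (h * x)]) (sq_nonneg h)

theorem cosQuadratic_le_sq {h : ℝ} (hh : h ≠ 0) (x : ℝ) : cosQuadratic h x ≤ x ^ 2 := by
  rw [cosQuadratic, div_le_iff₀ (by positivity)]
  nlinarith [Real.one_sub_sq_div_two_le_cos (x := h * x)]

theorem cosQuadratic_eq (h x : ℝ) : cosQuadratic h x = (2 * Real.sin (h * x / 2) / h) ^ 2 := by
  rw [cosQuadratic, div_pow, mul_pow, Real.sin_sq_eq_half_sub]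
  congr 1
  rw [mul_div_cancel₀ (h * x) two_ne_zero]
  ring

/-- By the half-angle formula this is the square of a difference quotient of `h ↦ 2 sin (h x / 2)`
at `0`. -/
theorem tendsto_cosQuadratic (x : ℝ) :
    Tendsto (fun n : ℕ => cosQuadratic (1 / ((n : ℝ) + 1)) x) atTop (𝓝 (x ^ 2)) := by
  have h1 : HasDerivAt (fun h : ℝ => 2 * Real.sin (h * x / 2)) x 0 := by
    have := ((((hasDerivAt_id' (0 : ℝ)).mul_const x).div_const 2).sin).const_mul 2
    simp only [zero_mul, zero_div, Real.cos_zero, one_mul] at this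
    rwa [mul_div_cancel₀ x two_ne_zero] at this
  have h2 := (hasDerivAt_iff_tendsto_slope_zero.1 h1)
  have h3 : Tendsto (fun n : ℕ => 1 / ((n : ℝ) + 1)) atTop (𝓝[≠] 0) := by
    refine tendsto_nhdsWithin_iff.2 ⟨tendsto_one_div_add_atTop_nhds_zero_nat, ?_⟩
    filter_upwards with n
    have : (0 : ℝ) < 1 / ((n : ℝ) + 1) := by positivity
    exact this.ne'
  have h4 := ((h2.comp h3).pow 2)
  refine h4.congr fun n => ?_
  rw [cosQuadratic_eq]
  simp only [Function.comp_apply, zero_add, zero_mul, zero_div, Real.sin_zero, mul_zero, sub_zero,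
    smul_eq_mul]
  ring

/-- The exponent starts at `1` because the constant `1` does not vanish at the origin. -/
theorem cosQuadratic_pow_mem_cosPoly (h : ℝ) (k : ℕ) :
    (fun x => cosQuadratic h x ^ (k + 1)) ∈ cosPoly := by
  have h1 : (fun x => cosQuadratic h x) ∈ cosPoly := by
    have : (fun x => cosQuadratic h x) = (-2 / h ^ 2) • fun x : ℝ => Real.cos (h * x) - 1 := by
      ext x
      simp only [cosQuadratic, Pi.smul_apply, smul_eq_mul]
      ring
    rw [this]
    exact cosPoly.smul_mem _ (cos_sub_one_mem_cosPoly h)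
  induction k with
  | zero => simpa using h1
  | succ k ih =>
    have := mul_mem_cosPoly ih h1
    exact this

/-- The partial sums of the expansion of `cosh - 1` with `x ^ 2` replaced by `cosQuadratic h x`. -/
noncomputable def coshApprox (n : ℕ) (h x : ℝ) : ℝ :=
  ∑ k ∈ Finset.range n, cosQuadratic h x ^ (k + 1) / ((2 * (k + 1)).factorial : ℝ)

theorem coshApprox_mem_cosPoly (n : ℕ) (h : ℝ) : coshApprox n h ∈ cosPoly := by
  have : coshApprox n h = ∑ k ∈ Finset.range n,
      (((2 * (k + 1)).factorial : ℝ)⁻¹) • fun x => cosQuadratic h x ^ (k + 1) := by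
    ext x
    simp [coshApprox, Finset.sum_apply, div_eq_inv_mul]
  rw [this]
  exact cosPoly.sum_mem fun k _ => cosPoly.smul_mem _ (cosQuadratic_pow_mem_cosPoly h k)

theorem hasSum_cosh_sub_one (x : ℝ) :
    HasSum (fun k : ℕ => (x ^ 2) ^ (k + 1) / ((2 * (k + 1)).factorial : ℝ)) (Real.cosh x - 1) := by
  have h := (hasSum_nat_add_iff' 1).2 (Real.hasSum_cosh x)
  simpa [pow_mul] using h

theorem coshApprox_le (n : ℕ) {h : ℝ} (hh : h ≠ 0) (x : ℝ) :
    coshApprox n h x ≤ Real.cosh x - 1 := by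
  refine le_trans (Finset.sum_le_sum fun k _ => ?_)
    ((hasSum_cosh_sub_one x).summable.sum_le_tsum (Finset.range n) fun k _ => by positivity)
    |>.trans (hasSum_cosh_sub_one x).tsum_eq.le
  have := pow_le_pow_left₀ (cosQuadratic_nonneg h x) (cosQuadratic_le_sq hh x) (k + 1)
  gcongr

theorem coshApprox_nonneg (n : ℕ) (h x : ℝ) : 0 ≤ coshApprox n h x :=
  Finset.sum_nonneg fun k _ => div_nonneg (pow_nonneg (cosQuadratic_nonneg h x) _) (by positivity)

/-- Fatou twice: `h → 0` with the truncation fixed, then the truncation to infinity. Finiteness of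
`η` plays no role, so this serves Lévy measures as well as laws. -/
theorem lintegral_cosh_sub_one_le {η : Measure ℝ} {C : ℝ≥0∞}
    (hC : ∀ n h, h ≠ 0 → ∫⁻ x, ENNReal.ofReal (coshApprox n h x) ∂η ≤ C) :
    ∫⁻ x, ENNReal.ofReal (Real.cosh x - 1) ∂η ≤ C := by
  refine lintegral_le_of_tendsto_of_le
    (f := fun n x => ∑ k ∈ Finset.range n, (x ^ 2) ^ (k + 1) / ((2 * (k + 1)).factorial : ℝ))
    (fun n => by fun_prop) (fun x => (hasSum_cosh_sub_one x).tendsto_sum_nat) fun n => ?_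
  refine lintegral_le_of_tendsto_of_le
    (f := fun j x => coshApprox n (1 / ((j : ℝ) + 1)) x)
    (fun j => (continuous_of_mem_cosPoly (coshApprox_mem_cosPoly _ _)).measurable)
    (fun x => ?_) fun j => hC n _ (by positivity)
  exact tendsto_finsetSum _ fun k _ => ((tendsto_cosQuadratic x).pow _).div_const _

/-! ### From laws of convolution roots to the Lévy measure -/

/-- Convergence of rescaled laws with characteristic functions `exp (c ψ / m)` to the Lévy measure,
tested against trigonometric polynomials. -/
theorem integrable_and_tendsto_of_mem_cosPoly {σ : ℕ → Measure ℝ} [∀ m, IsProbabilityMeasure (σ m)]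
    {η : Measure ℝ} {c : ℝ}
    (hη : ∀ t : ℝ, Integrable (fun x => Real.cos (t * x) - 1) η)
    (hσ : ∀ (m : ℕ) (t : ℝ), ∫ x, Real.cos (t * x) ∂(σ m)
      = Real.exp ((c * ∫ x, (Real.cos (t * x) - 1) ∂η) / ((m : ℝ) + 1)))
    {g : ℝ → ℝ} (hg : g ∈ cosPoly) :
    (∀ m, Integrable g (σ m)) ∧ Integrable g η ∧
      Tendsto (fun m : ℕ => ((m : ℝ) + 1) * ∫ x, g x ∂(σ m)) atTop (𝓝 (c * ∫ x, g x ∂η)) := by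
  induction hg using Submodule.span_induction with
  | mem g h =>
    obtain ⟨t, rfl⟩ := h
    have hint : ∀ m, Integrable (fun x : ℝ => Real.cos (t * x)) (σ m) := fun m =>
      Integrable.of_bound (by fun_prop) 1
        (Eventually.of_forall fun x => by simpa using Real.abs_cos_le_one (t * x))
    refine ⟨fun m => (hint m).sub (integrable_const 1), hη t, ?_⟩
    set ψ := c * ∫ x, (Real.cos (t * x) - 1) ∂η with hψ
    -- `(m + 1) (exp (ψ / (m + 1)) - 1)` is the difference quotient of `exp (ψ h)` at `0` with step
    -- `1 / (m + 1)`.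
    have h1 : HasDerivAt (fun h : ℝ => Real.exp (ψ * h)) ψ 0 := by
      simpa using ((hasDerivAt_id (0 : ℝ)).const_mul ψ).exp
    have h3 : Tendsto (fun n : ℕ => 1 / ((n : ℝ) + 1)) atTop (𝓝[≠] 0) := by
      refine tendsto_nhdsWithin_iff.2 ⟨tendsto_one_div_add_atTop_nhds_zero_nat, ?_⟩
      filter_upwards with n
      have : (0 : ℝ) < 1 / ((n : ℝ) + 1) := by positivity
      exact this.ne'
    refine ((hasDerivAt_iff_tendsto_slope_zero.1 h1).comp h3).congr fun m => ?_
    rw [integral_sub (hint m) (integrable_const 1), hσ m t]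
    simp [← hψ, div_eq_mul_inv]
  | zero => simp
  | add f g _ _ hf hg =>
    refine ⟨fun m => (hf.1 m).add (hg.1 m), hf.2.1.add hg.2.1, ?_⟩
    simp only [Pi.add_apply]
    rw [integral_add hf.2.1 hg.2.1, mul_add]
    refine (hf.2.2.add hg.2.2).congr fun m => ?_
    rw [integral_add (hf.1 m) (hg.1 m), mul_add]
  | smul a f _ hf =>
    refine ⟨fun m => (hf.1 m).smul a, hf.2.1.smul a, ?_⟩
    simp only [Pi.smul_apply, smul_eq_mul, integral_const_mul]
    have := hf.2.2.const_mul a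
    rw [mul_left_comm] at this
    exact this.congr fun m => by ring

theorem lintegral_cosh_sub_one_lt_top {σ : ℕ → Measure ℝ} [∀ m, IsProbabilityMeasure (σ m)]
    {η : Measure ℝ} {c K : ℝ} (hc : 0 < c)
    (hη : ∀ t : ℝ, Integrable (fun x => Real.cos (t * x) - 1) η)
    (hσ : ∀ (m : ℕ) (t : ℝ), ∫ x, Real.cos (t * x) ∂(σ m)
      = Real.exp ((c * ∫ x, (Real.cos (t * x) - 1) ∂η) / ((m : ℝ) + 1)))
    (hcosh : ∀ m, Integrable Real.cosh (σ m))
    (hK : ∀ m, (∫ x, Real.cosh x ∂(σ m)) ^ (m + 1) ≤ K) :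
    ∫⁻ x, ENNReal.ofReal (Real.cosh x - 1) ∂η < ∞ := by
  refine (lintegral_cosh_sub_one_le (C := ENNReal.ofReal ((K - 1) / c)) fun n h hh => ?_).trans_lt
    ENNReal.ofReal_lt_top
  obtain ⟨h1, h2, h3⟩ := integrable_and_tendsto_of_mem_cosPoly hη hσ (coshApprox_mem_cosPoly n h)
  rw [← ofReal_integral_eq_lintegral_ofReal h2 (Eventually.of_forall (coshApprox_nonneg n h))]
  refine ENNReal.ofReal_le_ofReal ?_
  rw [le_div_iff₀ hc, mul_comm]
  refine le_of_tendsto h3 (Eventually.of_forall fun m => ?_)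
  set A := ∫ x, Real.cosh x ∂(σ m) with hA
  have h4 : ∫ x, coshApprox n h x ∂(σ m) ≤ A - 1 := by
    have : A - 1 = ∫ x, (Real.cosh x - 1) ∂(σ m) := by
      rw [integral_sub (hcosh m) (integrable_const 1)]
      simp [hA]
    rw [this]
    exact integral_mono (h1 m) ((hcosh m).sub (integrable_const 1)) (coshApprox_le n hh)
  have h5 : 0 ≤ A - 1 :=
    (integral_nonneg (coshApprox_nonneg n h)).trans h4
  -- Bernoulli turns `A ^ (m + 1) ≤ K` into `(m + 1) (A - 1) ≤ K - 1`, a bound uniform in `m`.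
  have h6 := one_add_mul_le_pow (a := A - 1) (by linarith) (m + 1)
  have h7 := hK m
  push_cast at h6
  have h8 : (1 + (A - 1)) ^ (m + 1) = A ^ (m + 1) := by congr 1; ring
  rw [h8] at h6
  have h9 := mul_le_mul_of_nonneg_left h4 (by positivity : (0 : ℝ) ≤ (m : ℝ) + 1)
  linarith

/-! ### Convolution powers and symmetrization -/

section ConvPow

variable {d : ℕ} (ν : Measure (EuclideanSpace ℝ (Fin d))) [IsProbabilityMeasure ν]

theorem isProbabilityMeasure_convPow (n : ℕ) : IsProbabilityMeasure (convPow ν n) := by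
  induction n with
  | zero => exact Measure.dirac.isProbabilityMeasure
  | succ n ih => exact inferInstanceAs (IsProbabilityMeasure ((convPow ν n).conv ν))

theorem charFun_convPow (n : ℕ) (t : EuclideanSpace ℝ (Fin d)) :
    charFun (convPow ν n) t = charFun ν t ^ n := by
  induction n with
  | zero => simp [convPow]
  | succ n ih =>
    have := isProbabilityMeasure_convPow ν n
    rw [convPow, charFun_conv, ih, pow_succ]

theorem lintegral_exp_inner_convPow (n : ℕ) (a : EuclideanSpace ℝ (Fin d)) :
    ∫⁻ x, ENNReal.ofReal (Real.exp (inner ℝ x a)) ∂(convPow ν n)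
      = (∫⁻ x, ENNReal.ofReal (Real.exp (inner ℝ x a)) ∂ν) ^ n := by
  induction n with
  | zero => simp [convPow]
  | succ n ih =>
    have hm : Measurable fun x : EuclideanSpace ℝ (Fin d) =>
        ENNReal.ofReal (Real.exp (inner ℝ x a)) := by fun_prop
    rw [convPow, Measure.lintegral_conv hm, pow_succ, ← ih, ← lintegral_mul_const _ hm]
    refine lintegral_congr fun x => ?_
    rw [← lintegral_const_mul _ hm]
    refine lintegral_congr fun y => ?_
    rw [inner_add_left, Real.exp_add, ENNReal.ofReal_mul (Real.exp_nonneg _)]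

/-- The multiplicativity of the `lintegral` holds with infinite values too, so a finite `n`-th power
forces a finite base. -/
theorem integrable_exp_inner_of_convPow {n : ℕ} (hn : n ≠ 0) {a : EuclideanSpace ℝ (Fin d)}
    (h : Integrable (fun x => Real.exp (inner ℝ x a)) (convPow ν n)) :
    Integrable (fun x => Real.exp (inner ℝ x a)) ν ∧
      (∫ x, Real.exp (inner ℝ x a) ∂ν) ^ n = ∫ x, Real.exp (inner ℝ x a) ∂(convPow ν n) := by
  have key := lintegral_exp_inner_convPow ν n a
  have hfin : ∫⁻ x, ENNReal.ofReal (Real.exp (inner ℝ x a)) ∂ν ≠ ∞ := by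
    intro htop
    rw [htop, ENNReal.top_pow hn] at key
    exact (lintegral_ofReal_ne_top_iff_integrable h.aestronglyMeasurable
      (Eventually.of_forall fun x => Real.exp_nonneg _)).2 h key
  have hm : AEStronglyMeasurable (fun x : EuclideanSpace ℝ (Fin d) => Real.exp (inner ℝ x a)) ν := by
    fun_prop
  refine ⟨(lintegral_ofReal_ne_top_iff_integrable hm
    (Eventually.of_forall fun x => Real.exp_nonneg _)).1 hfin, ?_⟩
  rw [integral_eq_lintegral_of_nonneg_ae (Eventually.of_forall fun x => Real.exp_nonneg _) hm,
    integral_eq_lintegral_of_nonneg_ae (Eventually.of_forall fun x => Real.exp_nonneg _)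
      h.aestronglyMeasurable, key, ENNReal.toReal_pow]

/-- The law of `⟪X - X', a⟫` for independent `X, X'` with law `ν`. -/
noncomputable def symmetrizedLaw (ν : Measure (EuclideanSpace ℝ (Fin d)))
    (a : EuclideanSpace ℝ (Fin d)) : Measure ℝ :=
  (ν.prod ν).map fun p => inner ℝ (p.1 - p.2) a

theorem isProbabilityMeasure_symmetrizedLaw (a : EuclideanSpace ℝ (Fin d)) :
    IsProbabilityMeasure (symmetrizedLaw ν a) :=
  Measure.isProbabilityMeasure_map (by fun_prop)

/-- Symmetrizing removes the phase: the characteristic function of `X - X'` is `φ` times its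
conjugate, hence real and nonnegative, with a well-defined positive root. -/
theorem integral_cos_symmetrizedLaw (a : EuclideanSpace ℝ (Fin d)) (t : ℝ) :
    ∫ x, Real.cos (t * x) ∂(symmetrizedLaw ν a) = ‖charFun ν (t • a)‖ ^ 2 := by
  have h1 : ∫ p : EuclideanSpace ℝ (Fin d) × EuclideanSpace ℝ (Fin d),
      Complex.exp ((inner ℝ p.1 (t • a) : ℝ) * Complex.I)
        * Complex.exp ((inner ℝ p.2 (-(t • a)) : ℝ) * Complex.I) ∂(ν.prod ν)
      = ((‖charFun ν (t • a)‖ ^ 2 : ℝ) : ℂ) := by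
    rw [integral_prod_mul (μ := ν) (ν := ν)
      (fun x => Complex.exp ((inner ℝ x (t • a) : ℝ) * Complex.I))
      (fun x => Complex.exp ((inner ℝ x (-(t • a)) : ℝ) * Complex.I))]
    change charFun ν (t • a) * charFun ν (-(t • a)) = _
    rw [charFun_neg, Complex.mul_conj, Complex.normSq_eq_norm_sq]
  have h2 : Integrable (fun p : EuclideanSpace ℝ (Fin d) × EuclideanSpace ℝ (Fin d) =>
      Complex.exp ((inner ℝ p.1 (t • a) : ℝ) * Complex.I)
        * Complex.exp ((inner ℝ p.2 (-(t • a)) : ℝ) * Complex.I)) (ν.prod ν) := by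
    refine Integrable.of_bound (by fun_prop) 1 (Eventually.of_forall fun p => ?_)
    rw [norm_mul, Complex.norm_exp_ofReal_mul_I, Complex.norm_exp_ofReal_mul_I, one_mul]
  rw [symmetrizedLaw, integral_map (by fun_prop) (by fun_prop)]
  have h3 := congrArg Complex.re h1
  rw [Complex.ofReal_re] at h3
  rw [← h3, ← RCLike.re_eq_complex_re, ← integral_re h2]
  refine integral_congr_ae (Eventually.of_forall fun p => ?_)
  simp only [RCLike.re_eq_complex_re]
  rw [← Complex.exp_add, ← add_mul, ← Complex.ofReal_add, Complex.exp_ofReal_mul_I_re,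
    inner_neg_right, ← sub_eq_add_neg, ← inner_sub_left, inner_smul_right]

theorem integrable_cosh_symmetrizedLaw {a : EuclideanSpace ℝ (Fin d)}
    (h1 : Integrable (fun x => Real.exp (inner ℝ x a)) ν)
    (h2 : Integrable (fun x => Real.exp (inner ℝ x (-a))) ν) :
    Integrable Real.cosh (symmetrizedLaw ν a) ∧
      ∫ x, Real.cosh x ∂(symmetrizedLaw ν a)
        = (∫ x, Real.exp (inner ℝ x a) ∂ν) * ∫ x, Real.exp (inner ℝ x (-a)) ∂ν := by
  have e : ∀ p : EuclideanSpace ℝ (Fin d) × EuclideanSpace ℝ (Fin d),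
      Real.cosh (inner ℝ (p.1 - p.2) a)
        = (Real.exp (inner ℝ p.1 a) * Real.exp (inner ℝ p.2 (-a))
          + Real.exp (inner ℝ p.1 (-a)) * Real.exp (inner ℝ p.2 a)) / 2 := by
    intro p
    rw [Real.cosh_eq, ← Real.exp_add, ← Real.exp_add, inner_sub_left, inner_neg_right,
      inner_neg_right]
    congr 3
    ring
  have i1 := h1.mul_prod h2
  have i2 := h2.mul_prod h1
  rw [symmetrizedLaw, integrable_map_measure Real.continuous_cosh.aestronglyMeasurable
    (by fun_prop), integral_map (by fun_prop) Real.continuous_cosh.aestronglyMeasurable]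
  refine ⟨((i1.add i2).div_const 2).congr (Eventually.of_forall fun p => (e p).symm), ?_⟩
  simp_rw [e]
  rw [integral_div, integral_add i1 i2,
    integral_prod_mul (μ := ν) (ν := ν) (fun x => Real.exp (inner ℝ x a))
      (fun x => Real.exp (inner ℝ x (-a))),
    integral_prod_mul (μ := ν) (ν := ν) (fun x => Real.exp (inner ℝ x (-a)))
      (fun x => Real.exp (inner ℝ x a))]
  ring

end ConvPow

/-! ### Projected Lévy measure and the nonexistence statement -/

section Levy

variable {d : ℕ} {N : Seminorm ℝ (EuclideanSpace ℝ (Fin d))}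

/-- The density `exp (-β(v) r) / r` of the Lévy measure in polar coordinates. -/
noncomputable def gammaDensity (β : unitSphere N → ℝ≥0) (p : unitSphere N × ℝ) : ℝ≥0 :=
  (Real.exp (-((β p.1 : ℝ) * p.2)) / p.2).toNNReal

theorem measurable_gammaDensity {β : unitSphere N → ℝ≥0} (hβ : Measurable β) :
    Measurable (gammaDensity β) := by
  unfold gammaDensity
  fun_prop

/-- The image of the Lévy measure of a multivariate Gamma distribution under `x ↦ ⟪x, a⟫`. -/
noncomputable def levyProj (α : Measure (unitSphere N)) (β : unitSphere N → ℝ≥0)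
    (a : EuclideanSpace ℝ (Fin d)) : Measure ℝ :=
  ((α.prod (volume.restrict (Set.Ioi 0))).withDensity fun p => gammaDensity β p).map
    fun p => p.2 * inner ℝ (p.1 : EuclideanSpace ℝ (Fin d)) a

variable {α : Measure (unitSphere N)} {β : unitSphere N → ℝ≥0}
  {μ : Measure (EuclideanSpace ℝ (Fin d))}

theorem ae_snd_pos [SFinite α] : ∀ᵐ p ∂(α.prod (volume.restrict (Set.Ioi (0 : ℝ)))), 0 < p.2 :=
  Measure.quasiMeasurePreserving_snd.ae (ae_restrict_mem measurableSet_Ioi)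

theorem re_gammaExponentIntegrand (a v : EuclideanSpace ℝ (Fin d)) (b t r : ℝ) :
    (gammaExponentIntegrand (t • a) v b r).re
      = (Real.cos (t * (r * inner ℝ v a)) - 1) * (Real.exp (-(b * r)) / r) := by
  rw [gammaExponentIntegrand, Complex.re_mul_ofReal, Complex.sub_re, mul_comm Complex.I,
    Complex.exp_ofReal_mul_I_re, Complex.one_re, inner_smul_right, mul_left_comm]

theorem measurable_proj (a : EuclideanSpace ℝ (Fin d)) :
    Measurable fun p : unitSphere N × ℝ => p.2 * inner ℝ (p.1 : EuclideanSpace ℝ (Fin d)) a := by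
  fun_prop

/-- The real part of the exponent, pushed forward by the projection; the square comes from `|exp w|
^ 2 = exp (2 Re w)`. -/
theorem integrable_cos_levyProj [IsFiniteMeasure α] (hβ : Measurable β)
    (hμ : IsMultivariateGamma N α β μ) (a : EuclideanSpace ℝ (Fin d)) (t : ℝ) :
    Integrable (fun x => Real.cos (t * x) - 1) (levyProj α β a) ∧
      ‖charFun μ (t • a)‖ ^ 2
        = Real.exp (2 * ∫ x, (Real.cos (t * x) - 1) ∂(levyProj α β a)) := by
  have hI := hμ.integrable_exponent (t • a)
  have e : (fun p : unitSphere N × ℝ => gammaDensity β p •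
        (Real.cos (t * (p.2 * inner ℝ (p.1 : EuclideanSpace ℝ (Fin d)) a)) - 1))
      =ᵐ[α.prod (volume.restrict (Set.Ioi (0 : ℝ)))]
      fun p => RCLike.re (gammaExponentIntegrand (t • a) p.1 (β p.1) p.2) := by
    filter_upwards [ae_snd_pos] with p hp
    rw [RCLike.re_eq_complex_re, re_gammaExponentIntegrand, gammaDensity, NNReal.smul_def,
      Real.coe_toNNReal _ (by positivity), smul_eq_mul, mul_comm]
  have hc : Continuous fun x : ℝ => Real.cos (t * x) - 1 := by fun_prop
  constructor
  · rw [levyProj, integrable_map_measure hc.aestronglyMeasurable (measurable_proj a).aemeasurable,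
      integrable_withDensity_iff_integrable_smul (measurable_gammaDensity hβ)]
    exact hI.re.congr e.symm
  · rw [levyProj, integral_map (measurable_proj a).aemeasurable hc.aestronglyMeasurable,
      integral_withDensity_eq_integral_smul (measurable_gammaDensity hβ), integral_congr_ae e,
      integral_re hI, hμ.charFun_eq, ← integral_prod _ hI, Complex.norm_exp, ← Real.exp_nat_mul]
    simp

theorem lintegral_levyProj [SFinite α] (hβ : Measurable β) (a : EuclideanSpace ℝ (Fin d))
    {f : ℝ → ℝ≥0∞} (hf : Measurable f) :
    ∫⁻ x, f x ∂(levyProj α β a) = ∫⁻ v, (∫⁻ r in Set.Ioi (0 : ℝ),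
      gammaDensity β (v, r) * f (r * inner ℝ (v : EuclideanSpace ℝ (Fin d)) a)) ∂α := by
  have hg := (measurable_gammaDensity hβ).coe_nnreal_ennreal
  have hf' : Measurable fun p : unitSphere N × ℝ =>
    f (p.2 * inner ℝ (p.1 : EuclideanSpace ℝ (Fin d)) a) := hf.comp (measurable_proj a)
  rw [levyProj, lintegral_map hf (measurable_proj a), lintegral_withDensity_eq_lintegral_mul _ hg
    hf', lintegral_prod _ (hg.mul hf').aemeasurable]
  rfl

/-- Once `exp (r s) ≥ 4`, one has `cosh (r s) - 1 ≥ exp (r s) / 4`, while `exp (-b r) ≥ exp (-r s)`.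
The integrand then dominates `1 / (4 r)`, which diverges at infinity. -/
theorem lintegral_gamma_cosh_eq_top {b s : ℝ} (hs : 0 < s) (hbs : b ≤ s) :
    ∫⁻ r in Set.Ioi (0 : ℝ), ((Real.exp (-(b * r)) / r).toNNReal : ℝ≥0∞)
      * ENNReal.ofReal (Real.cosh (r * s) - 1) = ∞ := by
  by_contra hfin
  set c := Real.log 4 / s with hc
  have hc0 : 0 < c := div_pos (Real.log_pos (by norm_num)) hs
  have hle : ∫⁻ r in Set.Ioi c, ENNReal.ofReal (1 / 4 * r⁻¹) ≤
      ∫⁻ r in Set.Ioi (0 : ℝ), ((Real.exp (-(b * r)) / r).toNNReal : ℝ≥0∞)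
      * ENNReal.ofReal (Real.cosh (r * s) - 1) := by
    refine le_trans (setLIntegral_mono_ae' measurableSet_Ioi (Eventually.of_forall fun r hr => ?_))
      (lintegral_mono_set (Set.Ioi_subset_Ioi hc0.le))
    have hr : c < r := hr
    have hr0 : 0 < r := hc0.trans hr
    change _ ≤ ENNReal.ofReal (Real.exp (-(b * r)) / r) * _
    rw [← ENNReal.ofReal_mul (by positivity)]
    refine ENNReal.ofReal_le_ofReal ?_
    rw [div_mul_eq_mul_div (Real.exp _), le_div_iff₀ hr0, mul_assoc, inv_mul_cancel₀ hr0.ne']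
    have h4 : 4 ≤ Real.exp (r * s) := by
      rw [← Real.log_le_iff_le_exp (by norm_num)]
      exact ((div_lt_iff₀ hs).1 hr).le
    have h5 : Real.exp (r * s) / 4 ≤ Real.cosh (r * s) - 1 := by
      rw [Real.cosh_eq]
      linarith [Real.exp_pos (-(r * s))]
    have h6 : Real.exp (-(r * s)) ≤ Real.exp (-(b * r)) := by
      refine Real.exp_le_exp.2 ?_
      nlinarith
    calc (1 / 4 * 1 : ℝ) = Real.exp (-(r * s)) * (Real.exp (r * s) / 4) := by
          rw [← mul_div_assoc, ← Real.exp_add]; simp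
      _ ≤ _ := mul_le_mul h6 h5 (by positivity) (by positivity)
  have h7 : Integrable (fun r : ℝ => 1 / 4 * r⁻¹) (volume.restrict (Set.Ioi c)) := by
    refine (lintegral_ofReal_ne_top_iff_integrable (by fun_prop) ?_).1
      (ne_top_of_le_ne_top hfin hle)
    filter_upwards [ae_restrict_mem measurableSet_Ioi] with r hr
    have : 0 < r := hc0.trans hr
    change 0 ≤ 1 / 4 * r⁻¹
    positivity
  have h8 := h7.const_mul 4
  exact not_integrableOn_Ioi_inv (h8.congr (Eventually.of_forall fun r => by ring))

theorem inner_lt_of_integrable_exp [IsFiniteMeasure α] (hβ : Measurable β)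
    (hμ : IsMultivariateGamma N α β μ) {a : EuclideanSpace ℝ (Fin d)}
    (h1 : Integrable (fun x => Real.exp (inner ℝ x a)) μ)
    (h2 : Integrable (fun x => Real.exp (inner ℝ x (-a))) μ)
    {v : unitSphere N} (hv : α {v} ≠ 0)
    (hpos : 0 < inner ℝ (v : EuclideanSpace ℝ (Fin d)) a) :
    inner ℝ (v : EuclideanSpace ℝ (Fin d)) a < β v := by
  by_contra! hle
  choose ν hν hνμ using fun m : ℕ => hμ.isInfinitelyDivisible (m + 1) m.succ_pos
  have hσ := fun m => isProbabilityMeasure_symmetrizedLaw (ν m) a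
  have hx1 := fun m => integrable_exp_inner_of_convPow (ν m) m.succ_ne_zero (a := a)
    (by rw [hνμ]; exact h1)
  have hx2 := fun m => integrable_exp_inner_of_convPow (ν m) m.succ_ne_zero (a := -a)
    (by rw [hνμ]; exact h2)
  have hc := fun m => integrable_cosh_symmetrizedLaw (ν m) (hx1 m).1 (hx2 m).1
  have hfin := lintegral_cosh_sub_one_lt_top (σ := fun m => symmetrizedLaw (ν m) a)
    (η := levyProj α β a) (c := 2)
    (K := (∫ x, Real.exp (inner ℝ x a) ∂μ) * ∫ x, Real.exp (inner ℝ x (-a)) ∂μ) two_pos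
    (fun t => (integrable_cos_levyProj hβ hμ a t).1) (fun m t => ?_) (fun m => (hc m).1)
    (fun m => ?_)
  · rw [lintegral_levyProj hβ a (by fun_prop)] at hfin
    refine hfin.ne (top_le_iff.1 ?_)
    refine le_trans ?_ (setLIntegral_le_lintegral {v} _)
    rw [lintegral_singleton]
    simp only [gammaDensity]
    rw [lintegral_gamma_cosh_eq_top hpos hle, ENNReal.top_mul hv]
  -- Nonnegative reals are compared through their `(m + 1)`-th powers, where the transform of the
  -- root becomes that of `μ`.
  · refine (pow_left_inj₀ (n := m + 1) (integral_cos_symmetrizedLaw (ν m) a t ▸ by positivity)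
      (Real.exp_nonneg _) m.succ_ne_zero).1 ?_
    rw [integral_cos_symmetrizedLaw, ← Real.exp_nat_mul, ← pow_mul, mul_comm 2, pow_mul,
      ← norm_pow, ← charFun_convPow, hνμ, (integrable_cos_levyProj hβ hμ a t).2]
    push_cast
    rw [mul_div_cancel₀ _ (by positivity)]
  · rw [(hc m).2, mul_pow, (hx1 m).2, (hx2 m).2, hνμ]

/-- The purely imaginary complex vector `-i a`. -/
noncomputable def negImag (a : EuclideanSpace ℝ (Fin d)) : EuclideanSpace ℂ (Fin d) :=
  WithLp.toLp 2 fun j => -Complex.I * a j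

theorem exp_bilinPair_negImag (a x : EuclideanSpace ℝ (Fin d)) :
    Complex.exp (Complex.I * bilinPair x (negImag a)) = (Real.exp (inner ℝ x a) : ℝ) := by
  rw [Complex.ofReal_exp]
  congr 1
  simp only [bilinPair, negImag, PiLp.inner_apply, Finset.mul_sum, Complex.ofReal_sum]
  refine Finset.sum_congr rfl fun j _ => ?_
  simp only [RCLike.inner_apply, conj_trivial, Complex.ofReal_mul]
  linear_combination (-(x j : ℂ) * a j) * Complex.I_mul_I

theorem integrable_exp_inner_of_exists {a : EuclideanSpace ℝ (Fin d)}
    (h : FourierLaplaceExistsAt μ (negImag a)) :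
    Integrable (fun x => Real.exp (inner ℝ x a)) μ := by
  have := h.re
  refine this.congr (Eventually.of_forall fun x => ?_)
  simp only [exp_bilinPair_negImag]
  exact Complex.ofReal_re _

theorem norm_negImag (a : EuclideanSpace ℝ (Fin d)) : ‖negImag a‖ = ‖a‖ := by
  simp [negImag, EuclideanSpace.norm_eq]

theorem seminorm_le_mul_norm (N : Seminorm ℝ (EuclideanSpace ℝ (Fin d))) :
    ∃ C : ℝ, 0 < C ∧ ∀ x, N x ≤ C * ‖x‖ := by
  refine ⟨∑ j, N (EuclideanSpace.single j 1) + 1, ?_, fun x => ?_⟩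
  · have : 0 ≤ ∑ j, N (EuclideanSpace.single j (1 : ℝ)) :=
      Finset.sum_nonneg fun j _ => apply_nonneg N _
    linarith
  · have hx : x = ∑ j, x j • EuclideanSpace.single j (1 : ℝ) := by
      have := (EuclideanSpace.basisFun (Fin d) ℝ).sum_repr x
      simpa using this.symm
    calc N x = N (∑ j, x j • EuclideanSpace.single j (1 : ℝ)) := by rw [← hx]
      _ ≤ ∑ j, N (x j • EuclideanSpace.single j (1 : ℝ)) := by
          exact Finset.le_sum_of_subadditive N (map_zero N).le (map_add_le_add N) _ _
      _ ≤ ∑ j, ‖x‖ * N (EuclideanSpace.single j (1 : ℝ)) := by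
          refine Finset.sum_le_sum fun j _ => ?_
          rw [map_smul_eq_mul]
          exact mul_le_mul_of_nonneg_right (PiLp.norm_apply_le x j) (apply_nonneg N _)
      _ ≤ _ := by
          rw [← Finset.mul_sum]
          linarith [norm_nonneg x]

theorem not_forall_fourierLaplaceExistsAt [IsFiniteMeasure α] (hβ : Measurable β)
    (hμ : IsMultivariateGamma N α β μ) {v : ℕ → unitSphere N}
    (hv : Tendsto (fun n => β (v n)) atTop (𝓝 0)) (hα : ∀ n, 0 < α {v n})
    {U : Set (EuclideanSpace ℂ (Fin d))} (hU : U ∈ 𝓝 0) :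
    ¬ ∀ z ∈ U, FourierLaplaceExistsAt μ z := by
  intro hex
  obtain ⟨ρ, hρ, hball⟩ := Metric.mem_nhds_iff.1 hU
  obtain ⟨C, hC, hNC⟩ := seminorm_le_mul_norm N
  have hnorm : ∀ n, 1 ≤ C * ‖(v n : EuclideanSpace ℝ (Fin d))‖ := fun n =>
    (show N (v n) = 1 from (v n).2) ▸ hNC (v n)
  -- The threshold is the lower bound for `⟨v_n, a⟩ = (ρ / 2) ‖v_n‖` that follows from `‖v_n‖ ≥ 1 /
  -- C`.
  have hev := hv.eventually (gt_mem_nhds (show (0 : ℝ≥0) < (ρ / (2 * C)).toNNReal from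
    Real.toNNReal_pos.2 (by positivity)))
  obtain ⟨n, hn⟩ := hev.exists
  have hn' : (β (v n) : ℝ) < ρ / (2 * C) := by
    have := NNReal.coe_lt_coe.2 hn
    rwa [Real.coe_toNNReal _ (by positivity)] at this
  set w := (v n).1 with hw
  have hw0 : 0 < ‖w‖ := by
    have h := hnorm n
    by_contra! h0
    nlinarith
  -- Parallel to `w` to maximize the inner product; length `ρ / 2` keeps the imaginary vectors of
  -- `±a` inside the ball.
  set a := (ρ / (2 * ‖w‖)) • w with ha
  have hna : ‖a‖ = ρ / 2 := by
    rw [ha, norm_smul, Real.norm_of_nonneg (by positivity)]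
    field_simp
  have hia : inner ℝ w a = ρ / 2 * ‖w‖ := by
    rw [ha, inner_smul_right, real_inner_self_eq_norm_sq]
    field_simp
  have hexp : ∀ b : EuclideanSpace ℝ (Fin d), ‖b‖ = ρ / 2 →
      Integrable (fun x => Real.exp (inner ℝ x b)) μ := fun b hb =>
    integrable_exp_inner_of_exists (hex _ (hball (by
      rw [mem_ball_zero_iff, norm_negImag, hb]; linarith)))
  have hlt := inner_lt_of_integrable_exp hβ hμ (hexp a hna) (hexp (-a) (by rw [norm_neg, hna]))
    (hα n).ne' (by rw [← hw, hia]; positivity)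
  rw [← hw, hia] at hlt
  have h1 : ρ / (2 * C) ≤ ρ / 2 * ‖w‖ := by
    rw [div_le_iff₀ (by positivity)]
    nlinarith [hnorm n]
  linarith

end Levy

/-! ### The Frullani integral -/

section Frullani

theorem norm_gammaKernel_le {b : ℝ} (c : ℝ) {r : ℝ} (hr : 0 < r) :
    ‖(Complex.exp (Complex.I * ((r * c : ℝ) : ℂ)) - 1) * ((Real.exp (-(b * r)) / r : ℝ) : ℂ)‖
      ≤ |c| * Real.exp (-(b * r)) := by
  rw [norm_mul, Complex.norm_real, Real.norm_of_nonneg (by positivity)]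
  calc _ ≤ ‖r * c‖ * (Real.exp (-(b * r)) / r) :=
        mul_le_mul_of_nonneg_right (Real.norm_exp_I_mul_ofReal_sub_one_le) (by positivity)
    _ = _ := by
        rw [norm_mul, Real.norm_of_nonneg hr.le, Real.norm_eq_abs]
        field_simp

theorem integrable_exp_neg_mul_Ioi {b : ℝ} (hb : 0 < b) :
    Integrable (fun r : ℝ => Real.exp (-(b * r))) (volume.restrict (Set.Ioi 0)) := by
  have := exp_neg_integrableOn_Ioi 0 hb
  simp only [neg_mul] at this
  exact this

theorem integral_exp_I_mul_exp_neg {b : ℝ} (hb : 0 < b) (c : ℝ) :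
    ∫ r in Set.Ioi (0 : ℝ), Complex.I * Complex.exp (Complex.I * ((r * c : ℝ) : ℂ))
      * ((Real.exp (-(b * r)) : ℝ) : ℂ) = Complex.I / (b - Complex.I * c) := by
  have h := integral_exp_mul_complex_Ioi (a := Complex.I * c - b) (by simpa using hb) 0
  have e : ∀ r : ℝ, Complex.I * Complex.exp (Complex.I * ((r * c : ℝ) : ℂ))
      * ((Real.exp (-(b * r)) : ℝ) : ℂ) = Complex.I * Complex.exp ((Complex.I * c - b) * r) := by
    intro r
    rw [Complex.ofReal_exp, mul_assoc, ← Complex.exp_add]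
    congr 2
    push_cast
    ring
  simp_rw [e]
  rw [integral_const_mul, h, Complex.ofReal_zero, mul_zero, Complex.exp_zero, ← neg_sub (b : ℂ),
    neg_div_neg_eq, mul_one_div]

/-- The Frullani integral `∫ (e ^ (i r c) - 1) e ^ (-b r) / r dr = log (b / (b - i c))`. -/
theorem integral_gammaKernel {b : ℝ} (hb : 0 < b) (c : ℝ) :
    ∫ r in Set.Ioi (0 : ℝ), (Complex.exp (Complex.I * ((r * c : ℝ) : ℂ)) - 1)
      * ((Real.exp (-(b * r)) / r : ℝ) : ℂ) = -Complex.log (1 - Complex.I * c / b) := by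
  have hbC : (b : ℂ) ≠ 0 := by exact_mod_cast hb.ne'
  have hre : ∀ c : ℝ, (1 - Complex.I * (c : ℂ) / b).re = 1 := by
    intro c
    rw [mul_div_assoc, ← Complex.ofReal_div]
    simp
  have hmeas : ∀ c : ℝ, Measurable fun r : ℝ =>
      (Complex.exp (Complex.I * ((r * c : ℝ) : ℂ)) - 1) * ((Real.exp (-(b * r)) / r : ℝ) : ℂ) := by
    intro c
    fun_prop
  -- Differentiating in `c` cancels the factor `1 / r` and leaves an elementary exponential
  -- integral.
  have hH : ∀ c : ℝ, HasDerivAt (fun c : ℝ => ∫ r in Set.Ioi (0 : ℝ),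
      (Complex.exp (Complex.I * ((r * c : ℝ) : ℂ)) - 1) * ((Real.exp (-(b * r)) / r : ℝ) : ℂ))
      (Complex.I / (b - Complex.I * c)) c := by
    intro c
    rw [← integral_exp_I_mul_exp_neg hb c]
    refine (hasDerivAt_integral_of_dominated_loc_of_deriv_le (s := Set.univ) univ_mem
      (F' := fun (c r : ℝ) => Complex.I * Complex.exp (Complex.I * ((r * c : ℝ) : ℂ))
      * ((Real.exp (-(b * r)) : ℝ) : ℂ)) (bound := fun r => Real.exp (-(b * r)))
      (Eventually.of_forall fun c => (hmeas c).aestronglyMeasurable) ?_ ?_ ?_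
      (integrable_exp_neg_mul_Ioi hb) ?_).2
    · refine ((integrable_exp_neg_mul_Ioi hb).const_mul |c|).mono' (hmeas c).aestronglyMeasurable ?_
      filter_upwards [ae_restrict_mem measurableSet_Ioi] with r hr
      exact norm_gammaKernel_le c hr
    · fun_prop
    · refine Eventually.of_forall fun r c _ => ?_
      rw [norm_mul, norm_mul, Complex.norm_I, mul_comm Complex.I, Complex.norm_exp_ofReal_mul_I,
        Complex.norm_real, Real.norm_of_nonneg (Real.exp_nonneg _)]
      simp
    · filter_upwards [ae_restrict_mem measurableSet_Ioi] with r hr c _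
      have hr' : (r : ℂ) ≠ 0 := by exact_mod_cast (ne_of_gt hr)
      have h1 : HasDerivAt (fun c : ℝ => ((r * c : ℝ) : ℂ)) (r : ℂ) c := by
        simpa using ((hasDerivAt_id c).const_mul r).ofReal_comp
      have h2 := (((h1.const_mul Complex.I).cexp).sub_const 1).mul_const
        ((Real.exp (-(b * r)) / r : ℝ) : ℂ)
      refine h2.congr_deriv ?_
      push_cast
      field_simp
  have hG : ∀ c : ℝ, HasDerivAt (fun c : ℝ => -Complex.log (1 - Complex.I * c / b))
      (Complex.I / (b - Complex.I * c)) c := by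
    intro c
    have h1 : HasDerivAt (fun c : ℝ => 1 - Complex.I * (c : ℂ) / b) (-(Complex.I / b)) c := by
      simpa using (((hasDerivAt_id c).ofReal_comp.const_mul Complex.I).div_const (b : ℂ)).const_sub 1
    have h2 := (h1.clog_real (Or.inl (by rw [hre]; exact one_pos))).neg
    refine h2.congr_deriv ?_
    have h3 : (1 - Complex.I * (c : ℂ) / b) ≠ 0 := fun h => by
      have := hre c
      rw [h] at this
      simp at this
    have h4 : (b : ℂ) - Complex.I * c = b * (1 - Complex.I * (c : ℂ) / b) := by
      field_simp
    rw [h4]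
    field_simp
  -- Both sides have the same derivative in `c` and vanish at `c = 0`.
  have hconst := is_const_of_deriv_eq_zero
    (f := fun c : ℝ => (∫ r in Set.Ioi (0 : ℝ),
      (Complex.exp (Complex.I * ((r * c : ℝ) : ℂ)) - 1) * ((Real.exp (-(b * r)) / r : ℝ) : ℂ))
      - -Complex.log (1 - Complex.I * c / b))
    (fun c => ((hH c).sub (hG c)).differentiableAt)
    (fun c => ((hH c).sub (hG c)).deriv.trans (sub_self _)) c 0
  refine sub_eq_zero.1 (hconst.trans ?_)
  simp

end Frullani

/-! ### Holomorphy and boundedness of the exponent on a tube -/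

section LogIntegral

theorem norm_log_le_of_half_le_re {u : ℂ} (hu : 1 / 2 ≤ u.re) :
    ‖Complex.log u‖ ≤ ‖u‖ + 1 + Real.pi := by
  have h1 : 1 / 2 ≤ ‖u‖ := hu.trans (Complex.re_le_norm u)
  have h0 : 0 < ‖u‖ := by linarith
  refine (Complex.norm_le_abs_re_add_abs_im _).trans ?_
  rw [Complex.log_re, Complex.log_im]
  refine add_le_add (abs_le.2 ⟨?_, ?_⟩) (Complex.abs_arg_le_pi u)
  · have := Real.log_le_sub_one_of_pos (inv_pos.2 h0)
    rw [Real.log_inv] at this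
    have h2 : ‖u‖⁻¹ ≤ 2 := by
      rw [inv_le_comm₀ h0 two_pos]
      linarith
    linarith
  · linarith [Real.log_le_sub_one_of_pos h0]

variable {d : ℕ}

/-- The inclusion `ℝ^d → ℂ^d`. -/
noncomputable def complexVec (x : EuclideanSpace ℝ (Fin d)) : EuclideanSpace ℂ (Fin d) :=
  WithLp.toLp 2 fun j => (x j : ℂ)

/-- The imaginary part of a complex vector. -/
noncomputable def imVec (z : EuclideanSpace ℂ (Fin d)) : EuclideanSpace ℝ (Fin d) :=
  WithLp.toLp 2 fun j => (z j).im

/-- The real part of a complex vector. -/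
noncomputable def reVec (z : EuclideanSpace ℂ (Fin d)) : EuclideanSpace ℝ (Fin d) :=
  WithLp.toLp 2 fun j => (z j).re

theorem norm_complexVec (x : EuclideanSpace ℝ (Fin d)) : ‖complexVec x‖ = ‖x‖ := by
  simp [complexVec, EuclideanSpace.norm_eq]

theorem norm_imVec_le (z : EuclideanSpace ℂ (Fin d)) : ‖imVec z‖ ≤ ‖z‖ := by
  rw [EuclideanSpace.norm_eq, EuclideanSpace.norm_eq]
  refine Real.sqrt_le_sqrt (Finset.sum_le_sum fun j _ => ?_)
  exact pow_le_pow_left₀ (norm_nonneg _) (Complex.abs_im_le_norm (z j)) 2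

theorem norm_reVec_le (z : EuclideanSpace ℂ (Fin d)) : ‖reVec z‖ ≤ ‖z‖ := by
  rw [EuclideanSpace.norm_eq, EuclideanSpace.norm_eq]
  refine Real.sqrt_le_sqrt (Finset.sum_le_sum fun j _ => ?_)
  exact pow_le_pow_left₀ (norm_nonneg _) (Complex.abs_re_le_norm (z j)) 2

theorem continuous_imVec : Continuous (imVec : EuclideanSpace ℂ (Fin d) → _) := by
  unfold imVec
  fun_prop

theorem complexVec_reVec_add (z : EuclideanSpace ℂ (Fin d)) :
    complexVec (reVec z) + Complex.I • complexVec (imVec z) = z := by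
  ext j
  simp [complexVec, reVec, imVec, mul_comm Complex.I]

theorem bilinPair_eq_inner (x : EuclideanSpace ℝ (Fin d)) (z : EuclideanSpace ℂ (Fin d)) :
    bilinPair x z = inner ℂ (complexVec x) z := by
  simp [bilinPair, complexVec, PiLp.inner_apply, mul_comm]

theorem norm_bilinPair_le (x : EuclideanSpace ℝ (Fin d)) (z : EuclideanSpace ℂ (Fin d)) :
    ‖bilinPair x z‖ ≤ ‖x‖ * ‖z‖ := by
  rw [bilinPair_eq_inner, ← norm_complexVec x]
  exact norm_inner_le_norm _ _

theorem norm_bilinPair_le_of_norm_le {x : EuclideanSpace ℝ (Fin d)} {C : ℝ} (hx : ‖x‖ ≤ C)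
    (z : EuclideanSpace ℂ (Fin d)) : ‖bilinPair x z‖ ≤ C * ‖z‖ :=
  (norm_bilinPair_le x z).trans (mul_le_mul_of_nonneg_right hx (norm_nonneg z))

theorem bilinPair_add_smul (x : EuclideanSpace ℝ (Fin d)) (A B : EuclideanSpace ℂ (Fin d)) (s : ℂ) :
    bilinPair x (A + s • B) = bilinPair x A + s * bilinPair x B := by
  simp only [bilinPair_eq_inner, inner_add_right, inner_smul_right]

theorem bilinPair_complexVec (x y : EuclideanSpace ℝ (Fin d)) :
    bilinPair x (complexVec y) = (inner ℝ x y : ℝ) := by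
  simp [bilinPair, complexVec, PiLp.inner_apply, mul_comm]

theorem bilinPair_im (x : EuclideanSpace ℝ (Fin d)) (z : EuclideanSpace ℂ (Fin d)) :
    (bilinPair x z).im = inner ℝ x (imVec z) := by
  simp [bilinPair, imVec, PiLp.inner_apply, mul_comm]

theorem measurable_bilinPair (z : EuclideanSpace ℂ (Fin d)) :
    Measurable fun x : EuclideanSpace ℝ (Fin d) => bilinPair x z := by
  unfold bilinPair
  fun_prop

/-- The reciprocal `1 - i vᵀ z / b` of the quotient `b / (b - i vᵀ z)`. -/
noncomputable def gammaDenom (z : EuclideanSpace ℂ (Fin d)) (v : EuclideanSpace ℝ (Fin d))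
    (b : ℝ) : ℂ :=
  1 - Complex.I * bilinPair v z / b

theorem gammaQuotient_eq_inv (z : EuclideanSpace ℂ (Fin d)) (v : EuclideanSpace ℝ (Fin d)) {b : ℝ}
    (hb : 0 < b) : gammaQuotient z v b = (gammaDenom z v b)⁻¹ := by
  have hbC : (b : ℂ) ≠ 0 := by exact_mod_cast hb.ne'
  have : gammaDenom z v b = (b - Complex.I * bilinPair v z) / b := by
    rw [gammaDenom, sub_div, div_self hbC]
  rw [this, inv_div, gammaQuotient]

theorem gammaDenom_re (z : EuclideanSpace ℂ (Fin d)) (v : EuclideanSpace ℝ (Fin d)) (b : ℝ) :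
    (gammaDenom z v b).re = 1 + inner ℝ v (imVec z) / b := by
  rw [gammaDenom, Complex.sub_re, Complex.div_ofReal_re, Complex.I_mul_re, bilinPair_im,
    Complex.one_re]
  ring

theorem half_le_gammaDenom_re {z : EuclideanSpace ℂ (Fin d)} {v : EuclideanSpace ℝ (Fin d)}
    {b κ : ℝ} (hκ : 0 < κ) (hb : κ ≤ b) (h : ‖v‖ * ‖imVec z‖ ≤ κ / 2) :
    1 / 2 ≤ (gammaDenom z v b).re := by
  have h1 := (abs_le.1 ((abs_real_inner_le_norm v (imVec z)).trans h)).1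
  have h2 : -(1 / 2) ≤ inner ℝ v (imVec z) / b := by
    rw [le_div_iff₀ (hκ.trans_le hb)]
    linarith
  rw [gammaDenom_re]
  linarith

theorem norm_gammaDenom_le {z : EuclideanSpace ℂ (Fin d)} {v : EuclideanSpace ℝ (Fin d)}
    {b κ C : ℝ} (hκ : 0 < κ) (hb : κ ≤ b) (hv : ‖v‖ ≤ C) :
    ‖gammaDenom z v b‖ ≤ 1 + C * ‖z‖ / κ := by
  refine (norm_sub_le _ _).trans ?_
  rw [norm_one, norm_div, norm_mul, Complex.norm_I, one_mul, Complex.norm_real,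
    Real.norm_of_nonneg (hκ.le.trans hb)]
  have hC := (norm_nonneg v).trans hv
  have : ‖bilinPair v z‖ ≤ C * ‖z‖ :=
    norm_bilinPair_le_of_norm_le hv z
  gcongr

variable {N : Seminorm ℝ (EuclideanSpace ℝ (Fin d))} {α : Measure (unitSphere N)}
  {β : unitSphere N → ℝ≥0} {κ C R : ℝ}

/-- The integral `∫ log (β(v) / (β(v) - i vᵀ z)) α(dv)`, with the quotient inverted. -/
noncomputable def logIntegral (α : Measure (unitSphere N)) (β : unitSphere N → ℝ≥0)
    (z : EuclideanSpace ℂ (Fin d)) : ℂ :=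
  ∫ v, -Complex.log (gammaDenom z v (β v)) ∂α

theorem measurable_log_gammaDenom (hβ : Measurable β) (z : EuclideanSpace ℂ (Fin d)) :
    Measurable fun v : unitSphere N => -Complex.log (gammaDenom z v (β v)) := by
  have := (measurable_bilinPair z).comp (measurable_subtype_coe (p := (· ∈ unitSphere N)))
  have h2 : Measurable fun v : unitSphere N => bilinPair (v : EuclideanSpace ℝ (Fin d)) z := this
  unfold gammaDenom
  fun_prop

theorem ae_half_le_gammaDenom_re (hκ : 0 < κ) (hβκ : ∀ᵐ v ∂α, κ ≤ (β v : ℝ))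
    (hC : ∀ v : unitSphere N, ‖(v : EuclideanSpace ℝ (Fin d))‖ ≤ C) (hR : C * R ≤ κ / 2)
    {z : EuclideanSpace ℂ (Fin d)} (hz : ‖imVec z‖ ≤ R) :
    ∀ᵐ v : unitSphere N ∂α, 1 / 2 ≤ (gammaDenom z v (β v)).re := by
  filter_upwards [hβκ] with v hv
  refine half_le_gammaDenom_re hκ hv (le_trans ?_ hR)
  exact mul_le_mul (hC v) hz (norm_nonneg _) ((norm_nonneg _).trans (hC v))

theorem log_gammaQuotient {z : EuclideanSpace ℂ (Fin d)} {v : EuclideanSpace ℝ (Fin d)} {b : ℝ}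
    (hb : 0 < b) (h : 1 / 2 ≤ (gammaDenom z v b).re) :
    gammaQuotient z v b ∈ Complex.slitPlane ∧
      Complex.log (gammaQuotient z v b) = -Complex.log (gammaDenom z v b) := by
  have hs : gammaDenom z v b ∈ Complex.slitPlane := Or.inl (by linarith)
  have hpos : 0 < (gammaDenom z v b).re := by linarith
  rw [gammaQuotient_eq_inv z v hb]
  refine ⟨Or.inl ?_, Complex.log_inv _ (Complex.mem_slitPlane_iff_arg.1 hs).1⟩
  rw [Complex.inv_re]
  exact div_pos hpos (Complex.normSq_pos.2 (Complex.slitPlane_ne_zero hs))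

theorem integrable_log_gammaDenom [IsFiniteMeasure α] (hβ : Measurable β) (hκ : 0 < κ)
    (hβκ : ∀ᵐ v ∂α, κ ≤ (β v : ℝ))
    (hC : ∀ v : unitSphere N, ‖(v : EuclideanSpace ℝ (Fin d))‖ ≤ C) (hR : C * R ≤ κ / 2)
    {z : EuclideanSpace ℂ (Fin d)} (hz : ‖imVec z‖ ≤ R) :
    Integrable (fun v : unitSphere N => -Complex.log (gammaDenom z v (β v))) α := by
  refine Integrable.of_bound (measurable_log_gammaDenom hβ z).aestronglyMeasurable
    (1 + C * ‖z‖ / κ + 1 + Real.pi) ?_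
  filter_upwards [hβκ, ae_half_le_gammaDenom_re hκ hβκ hC hR hz] with v hv hre
  rw [norm_neg]
  have := norm_log_le_of_half_le_re hre
  have := norm_gammaDenom_le (z := z) hκ hv (hC v)
  linarith

/-- The real part of `-log u` is `-log |u| ≤ log 2`. The bound is independent of `Re z`, which makes
the later Cauchy estimates uniform along the real axis. -/
theorem norm_exp_logIntegral_le [IsFiniteMeasure α] (hβ : Measurable β) (hκ : 0 < κ)
    (hβκ : ∀ᵐ v ∂α, κ ≤ (β v : ℝ))
    (hC : ∀ v : unitSphere N, ‖(v : EuclideanSpace ℝ (Fin d))‖ ≤ C) (hR : C * R ≤ κ / 2)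
    {z : EuclideanSpace ℂ (Fin d)} (hz : ‖imVec z‖ ≤ R) :
    ‖Complex.exp (logIntegral α β z)‖ ≤ Real.exp (α.real Set.univ * Real.log 2) := by
  have hI := integrable_log_gammaDenom hβ hκ hβκ hC hR hz
  rw [Complex.norm_exp, Real.exp_le_exp, logIntegral, ← RCLike.re_eq_complex_re, ← integral_re hI]
  have : α.real Set.univ * Real.log 2 = ∫ _ : unitSphere N, Real.log 2 ∂α := by simp
  rw [this]
  refine integral_mono_ae hI.re (integrable_const _) ?_
  filter_upwards [ae_half_le_gammaDenom_re hκ hβκ hC hR hz] with v hre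
  have h1 : 1 / 2 ≤ ‖gammaDenom z v (β v)‖ := hre.trans (Complex.re_le_norm _)
  have h2 := Real.log_le_log (by norm_num) h1
  rw [one_div, Real.log_inv] at h2
  simp only [RCLike.re_eq_complex_re, Complex.neg_re, Complex.log_re]
  linarith

theorem differentiableAt_logIntegral_line [IsFiniteMeasure α] (hβ : Measurable β) (hκ : 0 < κ)
    (hβκ : ∀ᵐ v ∂α, κ ≤ (β v : ℝ))
    (hC : ∀ v : unitSphere N, ‖(v : EuclideanSpace ℝ (Fin d))‖ ≤ C) (hR : C * R ≤ κ / 2)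
    (A B : EuclideanSpace ℂ (Fin d)) {s₀ : ℂ} (hs₀ : ‖imVec (A + s₀ • B)‖ < R) :
    DifferentiableAt ℂ (fun s : ℂ => logIntegral α β (A + s • B)) s₀ := by
  have hcont : Continuous fun s : ℂ => ‖imVec (A + s • B)‖ :=
    (continuous_imVec.comp (by fun_prop)).norm
  have hopen : IsOpen {s : ℂ | ‖imVec (A + s • B)‖ < R} := isOpen_lt hcont continuous_const
  have hne : ∀ {u : ℂ}, 1 / 2 ≤ u.re → u ≠ 0 ∧ 1 / 2 ≤ ‖u‖ := fun {u} hu =>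
    ⟨fun h => by rw [h, Complex.zero_re] at hu; linarith, hu.trans (Complex.re_le_norm u)⟩
  have hall : ∀ᵐ v : unitSphere N ∂α, ∀ s ∈ {s : ℂ | ‖imVec (A + s • B)‖ < R},
      1 / 2 ≤ (gammaDenom (A + s • B) v (β v)).re := by
    filter_upwards [hβκ] with v hv s hs
    refine half_le_gammaDenom_re hκ hv (le_trans ?_ hR)
    exact mul_le_mul (hC v) (le_of_lt hs) (norm_nonneg _) ((norm_nonneg _).trans (hC v))
  have hm : Measurable fun v : unitSphere N => bilinPair (v : EuclideanSpace ℝ (Fin d)) B :=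
    (measurable_bilinPair B).comp measurable_subtype_coe
  have hm2 : Measurable fun v : unitSphere N =>
      gammaDenom (A + s₀ • B) (v : EuclideanSpace ℝ (Fin d)) (β v) := by
    have : Measurable fun v : unitSphere N =>
      bilinPair (v : EuclideanSpace ℝ (Fin d)) (A + s₀ • B) :=
      (measurable_bilinPair _).comp measurable_subtype_coe
    unfold gammaDenom
    fun_prop
  refine (hasDerivAt_integral_of_dominated_loc_of_deriv_le (hopen.mem_nhds hs₀)
    (F := fun (s : ℂ) (v : unitSphere N) => -Complex.log (gammaDenom (A + s • B) v (β v)))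
    (F' := fun (s : ℂ) (v : unitSphere N) =>
      -(-(Complex.I * bilinPair (v : EuclideanSpace ℝ (Fin d)) B / (β v : ℝ))
        / gammaDenom (A + s • B) v (β v)))
    -- `C ‖B‖ / κ` bounds the derivative of the denominator, and `1 / 2` bounds the denominator from
    -- below.
    (bound := fun _ => C * ‖B‖ / κ / (1 / 2))
    (Eventually.of_forall fun s => (measurable_log_gammaDenom hβ _).aestronglyMeasurable)
    (integrable_log_gammaDenom hβ hκ hβκ hC hR hs₀.le)
    ?_ ?_ (integrable_const _) ?_).2.differentiableAt
  · refine Measurable.aestronglyMeasurable ?_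
    fun_prop
  · filter_upwards [hall, hβκ] with v hv hb s hs
    rw [norm_neg, norm_div, norm_neg, norm_div, norm_mul, Complex.norm_I, one_mul,
      Complex.norm_real, Real.norm_of_nonneg (hκ.le.trans hb)]
    have h1 := (hne (hv s hs)).2
    have h2 : ‖bilinPair (v : EuclideanSpace ℝ (Fin d)) B‖ ≤ C * ‖B‖ :=
      norm_bilinPair_le_of_norm_le (hC v) B
    have h3 : 0 ≤ C * ‖B‖ := (norm_nonneg _).trans h2
    gcongr
  · filter_upwards [hall] with v hv s hs
    have h1 : HasDerivAt (fun s : ℂ => gammaDenom (A + s • B) v (β v))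
        (-(Complex.I * bilinPair (v : EuclideanSpace ℝ (Fin d)) B / (β v : ℝ))) s := by
      simp only [gammaDenom, bilinPair_add_smul]
      simpa using (((((hasDerivAt_id s).mul_const (bilinPair (v : EuclideanSpace ℝ (Fin d)) B)
        ).const_add (bilinPair (v : EuclideanSpace ℝ (Fin d)) A)).const_mul Complex.I).div_const
        ((β v : ℝ) : ℂ)).const_sub 1
    exact (h1.clog (Or.inl (by linarith [hv s hs]))).neg

theorem charFun_eq_exp_logIntegral {μ : Measure (EuclideanSpace ℝ (Fin d))} (hκ : 0 < κ)
    (hβκ : ∀ᵐ v ∂α, κ ≤ (β v : ℝ)) (hμ : IsMultivariateGamma N α β μ)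
    (x : EuclideanSpace ℝ (Fin d)) :
    charFun μ x = Complex.exp (logIntegral α β (complexVec x)) := by
  rw [hμ.charFun_eq, logIntegral]
  congr 1
  refine integral_congr_ae ?_
  filter_upwards [hβκ] with v hv
  simp only [gammaExponentIntegrand, gammaDenom, bilinPair_complexVec]
  exact integral_gammaKernel (hκ.trans_le hv) _

/-- Equivalence of norms: `N` is continuous and attains a positive minimum on the compact Euclidean
sphere. The sphere is empty when `d = 0`, hence the case split. -/
theorem exists_norm_le_of_unitSphere (hN : ∀ x, N x = 0 → x = 0) :
    ∃ C : ℝ, 0 < C ∧ ∀ v : unitSphere N, ‖(v : EuclideanSpace ℝ (Fin d))‖ ≤ C := by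
  obtain ⟨K, hK, hNK⟩ := seminorm_le_mul_norm N
  have hcont : Continuous N := by
    refine (LipschitzWith.of_dist_le_mul (K := K.toNNReal) fun x y => ?_).continuous
    rw [Real.coe_toNNReal _ hK.le, dist_eq_norm, dist_eq_norm]
    exact (abs_sub_map_le_sub N x y).trans (hNK _)
  rcases (Metric.sphere (0 : EuclideanSpace ℝ (Fin d)) 1).eq_empty_or_nonempty with he | hne
  · refine ⟨1, one_pos, fun v => ?_⟩
    by_contra! h
    have h0 : ‖(v : EuclideanSpace ℝ (Fin d))‖ ≠ 0 := by linarith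
    have : (‖(v : EuclideanSpace ℝ (Fin d))‖⁻¹ • (v : EuclideanSpace ℝ (Fin d)))
        ∈ Metric.sphere (0 : EuclideanSpace ℝ (Fin d)) 1 := by
      rw [mem_sphere_zero_iff_norm, norm_smul, norm_inv, norm_norm, inv_mul_cancel₀ h0]
    rw [he] at this
    exact this
  · obtain ⟨x₀, hx₀, hmin⟩ := (isCompact_sphere (0 : EuclideanSpace ℝ (Fin d)) 1).exists_isMinOn
      hne hcont.continuousOn
    have hpos : 0 < N x₀ := by
      refine lt_of_le_of_ne (apply_nonneg N x₀) fun h => ?_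
      rw [hN x₀ h.symm] at hx₀
      simp at hx₀
    refine ⟨(N x₀)⁻¹, inv_pos.2 hpos, fun v => ?_⟩
    by_cases h0 : ‖(v : EuclideanSpace ℝ (Fin d))‖ = 0
    · rw [h0]; positivity
    · have h1 : N x₀ ≤ N (‖(v : EuclideanSpace ℝ (Fin d))‖⁻¹ • (v : EuclideanSpace ℝ (Fin d))) :=
        hmin (by
          rw [mem_sphere_zero_iff_norm, norm_smul, norm_inv, norm_norm, inv_mul_cancel₀ h0])
      rw [map_smul_eq_mul, (show N (v : EuclideanSpace ℝ (Fin d)) = 1 from v.2), mul_one, norm_inv,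
        norm_norm] at h1
      exact (le_inv_comm₀ hpos (lt_of_le_of_ne (norm_nonneg _) (Ne.symm h0))).1 h1

end LogIntegral

/-! ### Exponential moments from a bounded holomorphic extension -/

section Moments

/-- The symmetric difference operator with step `h`. -/
noncomputable def symmDiffOp (h : ℝ) (f : ℝ → ℂ) (t : ℝ) : ℂ :=
  f (t + h / 2) - f (t - h / 2)

/-- One difference costs a factor `|h|` and one derivative. Stating this for a tower `F` lets the
induction pass to the tower of differences. -/
theorem norm_iterate_symmDiffOp_le (h : ℝ) {M : ℝ} (n : ℕ) (F : ℕ → ℝ → ℂ)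
    (hF : ∀ j t, HasDerivAt (F j) (F (j + 1) t) t) (hM : ∀ t, ‖F n t‖ ≤ M) (t : ℝ) :
    ‖(symmDiffOp h)^[n] (F 0) t‖ ≤ |h| ^ n * M := by
  induction n generalizing F M t with
  | zero => simpa using hM t
  | succ n ih =>
    rw [Function.iterate_succ_apply]
    have := ih (M := |h| * M) (fun j => symmDiffOp h (F j)) (fun j t => ?_) (fun t => ?_) t
    · rwa [pow_succ, mul_assoc]
    · exact ((hF j _).comp_add_const t (h / 2)).sub ((hF j _).comp_sub_const t (h / 2))
    · have h1 := Convex.norm_image_sub_le_of_norm_hasDerivWithin_le (s := Set.univ)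
        (fun x _ => (hF n x).hasDerivWithinAt) (fun x _ => hM x) convex_univ
        (Set.mem_univ (t - h / 2)) (Set.mem_univ (t + h / 2))
      rw [show t + h / 2 - (t - h / 2) = h by ring, Real.norm_eq_abs, mul_comm] at h1
      exact h1

/-- Each difference multiplies the integrand by `exp (i h x / 2) - exp (-i h x / 2) = 2 i sin (h x /
2)`. -/
theorem iterate_symmDiffOp_charFun (ν : Measure ℝ) [IsFiniteMeasure ν] (h : ℝ) (n : ℕ) :
    (symmDiffOp h)^[n] (charFun ν) = fun t : ℝ => ∫ x : ℝ,
      Complex.exp (t * x * Complex.I) * (2 * Complex.I * Real.sin (h * x / 2)) ^ n ∂ν := by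
  induction n with
  | zero => ext t; simp [charFun_apply_real]
  | succ n ih =>
    rw [Function.iterate_succ_apply', ih]
    ext t
    have hint : ∀ t : ℝ, Integrable (fun x : ℝ =>
        Complex.exp (t * x * Complex.I) * (2 * Complex.I * Real.sin (h * x / 2)) ^ n) ν := by
      intro t
      refine Integrable.of_bound (by fun_prop) (2 ^ n) (Eventually.of_forall fun x => ?_)
      rw [norm_mul, ← Complex.ofReal_mul, Complex.norm_exp_ofReal_mul_I, one_mul, norm_pow,
        norm_mul, norm_mul, Complex.norm_I, Complex.norm_real]
      refine pow_le_pow_left₀ (by positivity) ?_ n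
      have := Real.abs_sin_le_one (h * x / 2)
      simpa using this
    rw [symmDiffOp, ← integral_sub (hint _) (hint _)]
    refine integral_congr_ae (Eventually.of_forall fun x => ?_)
    have e1 : Complex.exp ((t + h / 2 : ℝ) * x * Complex.I)
        - Complex.exp ((t - h / 2 : ℝ) * x * Complex.I)
        = Complex.exp (t * x * Complex.I) * (2 * Complex.I * Real.sin (h * x / 2)) := by
      have a1 : ((t + h / 2 : ℝ) : ℂ) * x * Complex.I
        = t * x * Complex.I + (h * x / 2 : ℂ) * Complex.I := by push_cast; ring
      have a2 : ((t - h / 2 : ℝ) : ℂ) * x * Complex.I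
        = t * x * Complex.I + (-(h * x / 2) : ℂ) * Complex.I := by push_cast; ring
      rw [a1, a2, Complex.exp_add, Complex.exp_add, Complex.exp_mul_I, Complex.exp_mul_I,
        Complex.exp_mul_I, Complex.cos_neg, Complex.sin_neg]
      push_cast
      ring
    simp only
    rw [← sub_mul, e1, pow_succ]
    ring

variable {ν : Measure ℝ} [IsFiniteMeasure ν] {Φ : ℂ → ℂ} {R B r : ℝ}

/-- Discs of radius `r` about real points stay in the strip, so Cauchy bounds the derivative of
order `2k` uniformly on the line. The `2k`-th symmetric difference at `0` is, up to sign, `h ^ (2k)`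
times the integral. -/
theorem integral_cosQuadratic_pow_le (hr : 0 < r) (hrR : r < R)
    (hΦ : DifferentiableOn ℂ Φ {s | |s.im| < R}) (hB : ∀ s : ℂ, |s.im| < R → ‖Φ s‖ ≤ B)
    (hν : ∀ t : ℝ, charFun ν t = Φ t) {h : ℝ} (hh : h ≠ 0) (k : ℕ) :
    ∫ x, cosQuadratic h x ^ k ∂ν ≤ (2 * k).factorial * B / r ^ (2 * k) := by
  have hopen : IsOpen {s : ℂ | |s.im| < R} :=
    isOpen_lt Complex.continuous_im.abs continuous_const
  have hball : ∀ t : ℝ, Metric.closedBall (t : ℂ) r ⊆ {s : ℂ | |s.im| < R} := by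
    intro t s hs
    have h1 := Complex.abs_im_le_norm (s - t)
    rw [Complex.sub_im, Complex.ofReal_im, sub_zero] at h1
    exact (h1.trans (mem_closedBall_iff_norm.1 hs)).trans_lt hrR
  have han : AnalyticOnNhd ℂ Φ {s | |s.im| < R} := hΦ.analyticOnNhd hopen
  have hF : ∀ (j : ℕ) (t : ℝ), HasDerivAt (fun t : ℝ => iteratedDeriv j Φ (t : ℂ))
      (iteratedDeriv (j + 1) Φ (t : ℂ)) t := by
    intro j t
    have h1 : (t : ℂ) ∈ {s : ℂ | |s.im| < R} := hball t (Metric.mem_closedBall_self hr.le)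
    have h2 := (han.iterated_deriv j t h1).differentiableAt.hasDerivAt.comp_ofReal
    rw [iteratedDeriv_succ, iteratedDeriv_eq_iterate]
    exact h2
  have hM : ∀ t : ℝ, ‖iteratedDeriv (2 * k) Φ (t : ℂ)‖ ≤ (2 * k).factorial * B / r ^ (2 * k) := by
    intro t
    refine Complex.norm_iteratedDeriv_le_of_forall_mem_sphere_norm_le _ hr ?_ fun z hz =>
      hB z (hball t (Metric.sphere_subset_closedBall hz))
    exact (hΦ.mono (hball t)).diffContOnCl_ball subset_rfl
  have h3 := norm_iterate_symmDiffOp_le h (2 * k) (fun j t => iteratedDeriv j Φ (t : ℂ)) hF hM 0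
  have h4 : (fun t : ℝ => iteratedDeriv 0 Φ (t : ℂ)) = charFun ν := by
    ext t
    rw [iteratedDeriv_zero, hν]
  rw [h4, iterate_symmDiffOp_charFun] at h3
  have h5 : ∀ x : ℝ, Complex.exp (((0 : ℝ) : ℂ) * x * Complex.I)
      * (2 * Complex.I * Real.sin (h * x / 2)) ^ (2 * k)
      = (-1) ^ k * ((h ^ (2 * k) * cosQuadratic h x ^ k : ℝ) : ℂ) := by
    intro x
    rw [cosQuadratic_eq, Complex.ofReal_zero, zero_mul, zero_mul, Complex.exp_zero, one_mul,
      pow_mul h, ← mul_pow, div_pow, mul_div_cancel₀ _ (pow_ne_zero 2 hh), pow_mul]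
    push_cast
    rw [← mul_pow]
    congr 1
    rw [mul_pow, mul_pow, Complex.I_sq]
    ring
  simp only [h5] at h3
  rw [integral_const_mul, norm_mul, norm_pow, norm_neg, norm_one, one_pow, one_mul,
    integral_complex_ofReal, Complex.norm_real, integral_const_mul, norm_mul, norm_pow,
    Real.norm_eq_abs h] at h3
  exact (le_abs_self _).trans (le_of_mul_le_mul_left h3 (by positivity))

theorem integrable_cosQuadratic_pow (h : ℝ) (k : ℕ) :
    Integrable (fun x => cosQuadratic h x ^ k) ν := by
  refine Integrable.of_bound (by unfold cosQuadratic; fun_prop) ((4 / h ^ 2) ^ k)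
    (Eventually.of_forall fun x => ?_)
  rw [norm_pow, Real.norm_of_nonneg (cosQuadratic_nonneg h x)]
  refine pow_le_pow_left₀ (cosQuadratic_nonneg h x) ?_ k
  unfold cosQuadratic
  gcongr
  linarith [Real.neg_one_le_cos (h * x)]

/-- A characteristic function that extends to a bounded holomorphic function on a strip of
half-width larger than one forces an exponential moment. -/
theorem integrable_cosh_of_charFun (hR : 1 < R)
    (hΦ : DifferentiableOn ℂ Φ {s | |s.im| < R}) (hB : ∀ s : ℂ, |s.im| < R → ‖Φ s‖ ≤ B)
    (hν : ∀ t : ℝ, charFun ν t = Φ t) : Integrable Real.cosh ν := by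
  obtain ⟨r, hr1, hrR⟩ := exists_between hR
  have hr0 : 0 < r := one_pos.trans hr1
  have hB0 : 0 ≤ B := (norm_nonneg _).trans (hB 0 (by simpa using one_pos.trans hR))
  have hq0 : 0 ≤ (r ^ 2)⁻¹ := by positivity
  have hq1 : (r ^ 2)⁻¹ < 1 := inv_lt_one_of_one_lt₀ (one_lt_pow₀ hr1 two_ne_zero)
  -- The factorial from Cauchy cancels the one in the `cosh` series, leaving a geometric series of
  -- ratio `r⁻² < 1`; this is where a half-width above one is needed.
  have key : ∫⁻ x, ENNReal.ofReal (Real.cosh x - 1) ∂ν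
      ≤ ENNReal.ofReal (∑' k : ℕ, B * ((r ^ 2)⁻¹) ^ (k + 1)) := by
    refine lintegral_cosh_sub_one_le fun n h hh => ?_
    have hint : ∀ k ∈ Finset.range n, Integrable
        (fun x => cosQuadratic h x ^ (k + 1) / ((2 * (k + 1)).factorial : ℝ)) ν := fun k _ =>
      (integrable_cosQuadratic_pow h (k + 1)).div_const _
    have hint' : Integrable (coshApprox n h) ν := integrable_finsetSum _ hint
    rw [← ofReal_integral_eq_lintegral_ofReal hint'
      (Eventually.of_forall (coshApprox_nonneg n h))]
    refine ENNReal.ofReal_le_ofReal ?_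
    simp only [coshApprox]
    rw [integral_finsetSum _ hint]
    have hsum : Summable fun k : ℕ => B * ((r ^ 2)⁻¹) ^ (k + 1) :=
      (((summable_nat_add_iff 1).2 (summable_geometric_of_lt_one hq0 hq1))).mul_left B
    refine (Finset.sum_le_sum fun k _ => ?_).trans
      (hsum.sum_le_tsum (Finset.range n) fun k _ => by positivity)
    rw [integral_div, div_le_iff₀ (by positivity)]
    refine (integral_cosQuadratic_pow_le hr0 hrR hΦ hB hν hh (k + 1)).trans (le_of_eq ?_)
    rw [pow_mul, inv_pow]
    field_simp
  have h1 : Integrable (fun x => Real.cosh x - 1) ν :=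
    (lintegral_ofReal_ne_top_iff_integrable (by fun_prop)
      (Eventually.of_forall fun x => sub_nonneg.2 (Real.one_le_cosh x))).1
      (key.trans_lt ENNReal.ofReal_lt_top).ne
  exact (h1.add (integrable_const (1 : ℝ))).congr
    (Eventually.of_forall fun x => sub_add_cancel _ _)

end Moments

/-! ### Analyticity from exponential moments -/

section Analytic

variable {d : ℕ} {μ : Measure (EuclideanSpace ℝ (Fin d))}

theorem norm_le_sum_abs (x : EuclideanSpace ℝ (Fin d)) : ‖x‖ ≤ ∑ j, |x j| := by
  have hx : x = ∑ j, x j • EuclideanSpace.single j (1 : ℝ) := by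
    have := (EuclideanSpace.basisFun (Fin d) ℝ).sum_repr x
    simpa using this.symm
  calc ‖x‖ = ‖∑ j, x j • EuclideanSpace.single j (1 : ℝ)‖ := by rw [← hx]
    _ ≤ ∑ j, ‖x j • EuclideanSpace.single j (1 : ℝ)‖ := norm_sum_le _ _
    _ = _ := by simp [norm_smul]

/-- Some coordinate has size at least `‖x‖ / (d + 1)`, unless `x = 0`, where the summand `1`
suffices. Using `d + 1` also covers `d = 0`. -/
theorem exp_mul_norm_le {s : ℝ} (hs : 0 < s) (x : EuclideanSpace ℝ (Fin d)) :
    Real.exp (s / (d + 1) * ‖x‖) ≤ 1 + ∑ j, 2 * Real.cosh (s * x j) := by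
  have hpos : ∀ j, 0 ≤ 2 * Real.cosh (s * x j) := fun j => by
    linarith [Real.one_le_cosh (s * x j)]
  by_cases hx : ∃ j, ‖x‖ / (d + 1) ≤ |x j|
  · obtain ⟨j, hj⟩ := hx
    have h1 : s / (d + 1) * ‖x‖ ≤ |s * x j| := by
      rw [abs_mul, abs_of_pos hs, div_mul_eq_mul_div, mul_div_assoc]
      exact mul_le_mul_of_nonneg_left hj hs.le
    have h2 : Real.exp |s * x j| ≤ 2 * Real.cosh (s * x j) := by
      rw [← Real.cosh_abs, Real.cosh_eq]
      linarith [Real.exp_pos (-|s * x j|)]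
    have h3 := Finset.single_le_sum (f := fun j => 2 * Real.cosh (s * x j))
      (fun j _ => hpos j) (Finset.mem_univ j)
    have h4 := Real.exp_le_exp.2 h1
    simp only at h3
    linarith
  · push Not at hx
    have h1 : ‖x‖ ≤ d * (‖x‖ / (d + 1)) := by
      refine (norm_le_sum_abs x).trans ((Finset.sum_le_sum fun j _ => (hx j).le).trans ?_)
      simp
    have h2 : ‖x‖ = ‖x‖ / (d + 1) + d * (‖x‖ / (d + 1)) := by field_simp; ring
    have h3 : ‖x‖ / (d + 1) ≤ 0 := by linarith
    have h4 : ‖x‖ ≤ 0 := by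
      rw [div_le_iff₀ (by positivity)] at h3
      linarith
    rw [le_antisymm h4 (norm_nonneg x), mul_zero, Real.exp_zero]
    linarith [Finset.sum_nonneg fun j (_ : j ∈ Finset.univ) => hpos j]

theorem integrable_exp_mul_norm [IsFiniteMeasure μ] {s : ℝ} (hs : 0 < s)
    (h : ∀ j, Integrable (fun x : EuclideanSpace ℝ (Fin d) => Real.cosh (s * x j)) μ) :
    Integrable (fun x => Real.exp (s / (d + 1) * ‖x‖)) μ := by
  refine ((integrable_const (1 : ℝ)).add (integrable_finsetSum Finset.univ
    fun j _ => (h j).const_mul 2)).mono' (by fun_prop) (Eventually.of_forall fun x => ?_)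
  rw [Real.norm_of_nonneg (Real.exp_nonneg _)]
  simpa using exp_mul_norm_le hs x

variable {ρ : ℝ}

theorem fourierLaplaceExistsAt_of_norm_le
    (hint : Integrable (fun x => Real.exp (ρ * ‖x‖)) μ) {z : EuclideanSpace ℂ (Fin d)}
    (hz : ‖z‖ ≤ ρ) : FourierLaplaceExistsAt μ z := by
  refine hint.mono' (((measurable_bilinPair z).const_mul _).cexp.aestronglyMeasurable)
    (Eventually.of_forall fun x => ?_)
  refine (Complex.norm_exp_le_exp_norm _).trans (Real.exp_le_exp.2 ?_)
  rw [norm_mul, Complex.norm_I, one_mul, mul_comm ρ]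
  exact (norm_bilinPair_le x z).trans (mul_le_mul_of_nonneg_left hz (norm_nonneg x))

theorem norm_pow_div_factorial_le (hρ : 0 < ρ) (n : ℕ) (x : EuclideanSpace ℝ (Fin d)) :
    ‖x‖ ^ n / n.factorial ≤ Real.exp (ρ * ‖x‖) / ρ ^ n := by
  have := Real.pow_div_factorial_le_exp _ (mul_nonneg hρ.le (norm_nonneg x)) n
  rw [le_div_iff₀ (by positivity), div_mul_eq_mul_div, mul_comm, ← mul_pow]
  exact this

/-- The degree-`n` Taylor term at `0`: the symmetric form is integrated in `x`, and `‖x‖ ^ n / n! ≤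
exp (ρ ‖x‖) / ρ ^ n` gives the norm bound for radius of convergence at least `ρ`. -/
theorem exists_momentForm (hρ : 0 < ρ) (hint : Integrable (fun x => Real.exp (ρ * ‖x‖)) μ)
    (n : ℕ) :
    ∃ p : ContinuousMultilinearMap ℂ (fun _ : Fin n => EuclideanSpace ℂ (Fin d)) ℂ,
      (∀ y, p (fun _ => y) = ∫ x, (Complex.I * bilinPair x y) ^ n / n.factorial ∂μ) ∧
      ‖p‖ ≤ (∫ x, Real.exp (ρ * ‖x‖) ∂μ) / ρ ^ n := by
  set T : EuclideanSpace ℝ (Fin d) →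
      MultilinearMap ℂ (fun _ : Fin n => EuclideanSpace ℂ (Fin d)) ℂ := fun x =>
    (Complex.I ^ n / n.factorial : ℂ) • (MultilinearMap.mkPiAlgebra ℂ (Fin n) ℂ).compLinearMap
      fun _ => (innerSL ℂ (complexVec x)).toLinearMap with hT
  have hTapp : ∀ x m, T x m = Complex.I ^ n / n.factorial * ∏ i, bilinPair x (m i) := by
    intro x m
    simp [hT, bilinPair_eq_inner]
  have hbound : ∀ x m, ‖T x m‖ ≤ Real.exp (ρ * ‖x‖) / ρ ^ n * ∏ i, ‖m i‖ := by
    intro x m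
    rw [hTapp, norm_mul, norm_div, norm_pow, Complex.norm_I, one_pow, norm_prod,
      Complex.norm_natCast]
    have h1 : ∏ i, ‖bilinPair x (m i)‖ ≤ ‖x‖ ^ n * ∏ i, ‖m i‖ := by
      refine (Finset.prod_le_prod (fun i _ => norm_nonneg _)
        fun i _ => norm_bilinPair_le x (m i)).trans (le_of_eq ?_)
      rw [Finset.prod_mul_distrib]
      simp
    calc 1 / (n.factorial : ℝ) * ∏ i, ‖bilinPair x (m i)‖
        ≤ 1 / (n.factorial : ℝ) * (‖x‖ ^ n * ∏ i, ‖m i‖) := by gcongr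
      _ = ‖x‖ ^ n / n.factorial * ∏ i, ‖m i‖ := by ring
      _ ≤ _ := mul_le_mul_of_nonneg_right (norm_pow_div_factorial_le hρ n x)
          (Finset.prod_nonneg fun i _ => norm_nonneg _)
  have hTint : ∀ m, Integrable (fun x => T x m) μ := by
    intro m
    refine ((hint.div_const (ρ ^ n)).mul_const (∏ i, ‖m i‖)).mono' ?_
      (Eventually.of_forall fun x => hbound x m)
    simp only [hTapp]
    exact ((Finset.measurable_prod _ fun i _ =>
      measurable_bilinPair (m i)).const_mul _).aestronglyMeasurable
  let M : MultilinearMap ℂ (fun _ : Fin n => EuclideanSpace ℂ (Fin d)) ℂ :=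
    { toFun := fun m => ∫ x, T x m ∂μ
      map_update_add' := fun m i y z => by
        simp only [MultilinearMap.map_update_add]
        exact integral_add (hTint _) (hTint _)
      map_update_smul' := fun m i c y => by
        simp only [MultilinearMap.map_update_smul]
        exact integral_smul c _ }
  have hM : ∀ m, ‖M m‖ ≤ (∫ x, Real.exp (ρ * ‖x‖) ∂μ) / ρ ^ n * ∏ i, ‖m i‖ := by
    intro m
    rw [← integral_div, ← integral_mul_const]
    exact norm_integral_le_of_norm_le ((hint.div_const (ρ ^ n)).mul_const _)
      (Eventually.of_forall fun x => hbound x m)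
  refine ⟨M.mkContinuous _ hM, fun y => ?_, M.mkContinuous_norm_le
    (div_nonneg (integral_nonneg fun x => Real.exp_nonneg _) (by positivity)) hM⟩
  change ∫ x, T x (fun _ => y) ∂μ = _
  refine integral_congr_ae (Eventually.of_forall fun x => ?_)
  simp only [hTapp, Finset.prod_const, Finset.card_univ, Fintype.card_fin]
  rw [mul_pow]
  ring

theorem hasSum_fourierLaplace (hρ : 0 < ρ) (hint : Integrable (fun x => Real.exp (ρ * ‖x‖)) μ)
    {z : EuclideanSpace ℂ (Fin d)} (hz : ‖z‖ < ρ) :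
    HasSum (fun n : ℕ => ∫ x, (Complex.I * bilinPair x z) ^ n / n.factorial ∂μ)
      (fourierLaplace μ z) := by
  have hbound : ∀ (n : ℕ) x, ‖(Complex.I * bilinPair x z) ^ n / (n.factorial : ℂ)‖
      ≤ Real.exp (ρ * ‖x‖) * (‖z‖ / ρ) ^ n := by
    intro n x
    rw [norm_div, norm_pow, norm_mul, Complex.norm_I, one_mul, Complex.norm_natCast]
    calc ‖bilinPair x z‖ ^ n / (n.factorial : ℝ) ≤ (‖x‖ * ‖z‖) ^ n / n.factorial := by
          have := norm_bilinPair_le x z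
          gcongr
      _ = ‖x‖ ^ n / n.factorial * ‖z‖ ^ n := by rw [mul_pow]; ring
      _ ≤ Real.exp (ρ * ‖x‖) / ρ ^ n * ‖z‖ ^ n :=
          mul_le_mul_of_nonneg_right (norm_pow_div_factorial_le hρ n x) (by positivity)
      _ = _ := by rw [div_pow]; ring
  have hi : ∀ n : ℕ, Integrable (fun x => (Complex.I * bilinPair x z) ^ n / (n.factorial : ℂ)) μ :=
    fun n => (hint.mul_const _).mono'
      ((((measurable_bilinPair z).const_mul _).pow_const n).div_const _).aestronglyMeasurable
      (Eventually.of_forall (hbound n))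
  have hs : Summable fun n : ℕ =>
      ∫ x, ‖(Complex.I * bilinPair x z) ^ n / (n.factorial : ℂ)‖ ∂μ := by
    refine Summable.of_nonneg_of_le (fun n => integral_nonneg fun x => norm_nonneg _)
      (fun n => integral_mono (hi n).norm (hint.mul_const _) (hbound n)) ?_
    simp only [integral_mul_const]
    exact (summable_geometric_of_lt_one (by positivity) ((div_lt_one hρ).2 hz)).mul_left _
  have h := hasSum_integral_of_summable_integral_norm hi hs
  have e : ∀ x : EuclideanSpace ℝ (Fin d), ∑' n : ℕ, (Complex.I * bilinPair x z) ^ n / (n.factorial : ℂ)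
      = Complex.exp (Complex.I * bilinPair x z) := by
    intro x
    rw [Complex.exp_eq_exp_ℂ, NormedSpace.exp_eq_tsum_div]
  simp only [e] at h
  exact h

theorem analyticOnNhd_fourierLaplace (hρ : 0 < ρ)
    (hint : Integrable (fun x => Real.exp (ρ * ‖x‖)) μ) :
    AnalyticOnNhd ℂ (fourierLaplace μ) (Metric.ball 0 ρ) := by
  choose p hp hpn using exists_momentForm hρ hint
  have hps : HasFPowerSeriesOnBall (fourierLaplace μ)
      (p : FormalMultilinearSeries ℂ (EuclideanSpace ℂ (Fin d)) ℂ) 0 (ENNReal.ofReal ρ) := by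
    refine ⟨?_, ENNReal.ofReal_pos.2 hρ, fun {y} hy => ?_⟩
    · refine FormalMultilinearSeries.le_radius_of_bound (r := ρ.toNNReal) _
        (∫ x, Real.exp (ρ * ‖x‖) ∂μ) fun n => ?_
      rw [Real.coe_toNNReal _ hρ.le, ← le_div_iff₀ (by positivity)]
      exact hpn n
    · rw [Metric.eball_ofReal, mem_ball_zero_iff] at hy
      rw [zero_add]
      simpa only [hp] using hasSum_fourierLaplace hρ hint hy
  have := hps.analyticOnNhd
  rwa [Metric.eball_ofReal] at this

end Analytic

/-! ### Moments of `μ` and the identity theorem -/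

section Main

variable {d : ℕ} {N : Seminorm ℝ (EuclideanSpace ℝ (Fin d))} {α : Measure (unitSphere N)}
  [IsFiniteMeasure α] {β : unitSphere N → ℝ≥0} {μ : Measure (EuclideanSpace ℝ (Fin d))}
  {κ C R : ℝ}

theorem norm_imVec_smul_complexVec (w : ℂ) (x : EuclideanSpace ℝ (Fin d)) :
    ‖imVec (0 + w • complexVec x)‖ = |w.im| * ‖x‖ := by
  have : imVec (0 + w • complexVec x) = w.im • x := by
    ext j
    simp [imVec, complexVec]
  rw [this, norm_smul, Real.norm_eq_abs]

theorem integrable_cosh_coord (hβ : Measurable β) (hκ : 0 < κ) (hβκ : ∀ᵐ v ∂α, κ ≤ (β v : ℝ))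
    (hC : ∀ v : unitSphere N, ‖(v : EuclideanSpace ℝ (Fin d))‖ ≤ C) (hR0 : 0 < R)
    (hR : C * R ≤ κ / 2) (hμ : IsMultivariateGamma N α β μ) (j : Fin d) :
    Integrable (fun x : EuclideanSpace ℝ (Fin d) => Real.cosh (R / 2 * x j)) μ := by
  have := hμ.isProbabilityMeasure
  have hm : Measurable fun x : EuclideanSpace ℝ (Fin d) => R / 2 * x j := by fun_prop
  -- Length `R / 2` makes the strip `|Im w| < 2` map into the tube `‖Im z‖ < R`; half-width `2`
  -- exceeds the required `1`.
  set b := EuclideanSpace.single j (R / 2) with hb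
  have hnb : ‖b‖ = R / 2 := by
    rw [hb, PiLp.norm_single, Real.norm_of_nonneg (by positivity)]
  have him : ∀ w : ℂ, |w.im| < 2 → ‖imVec (0 + w • complexVec b)‖ < R := by
    intro w hw
    rw [norm_imVec_smul_complexVec, hnb]
    nlinarith
  have hfin : IsFiniteMeasure (μ.map fun x : EuclideanSpace ℝ (Fin d) => R / 2 * x j) :=
    Measure.isFiniteMeasure_map μ _
  have h := integrable_cosh_of_charFun
    (ν := μ.map fun x : EuclideanSpace ℝ (Fin d) => R / 2 * x j)
    (Φ := fun w => Complex.exp (logIntegral α β (0 + w • complexVec b))) (R := 2)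
    one_lt_two (fun w hw => ?_)
    (fun w hw => norm_exp_logIntegral_le hβ hκ hβκ hC hR (him w hw).le) (fun t => ?_)
  · exact (integrable_map_measure Real.continuous_cosh.aestronglyMeasurable hm.aemeasurable).1 h
  · exact (differentiableAt_logIntegral_line hβ hκ hβκ hC hR 0 (complexVec b)
      (him w hw)).cexp.differentiableWithinAt
  · have e : (0 : EuclideanSpace ℂ (Fin d)) + (t : ℂ) • complexVec b = complexVec (t • b) := by
      ext i
      simp [complexVec]
    rw [e, ← charFun_eq_exp_logIntegral hκ hβκ hμ, charFun_apply_real, charFun_apply,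
      integral_map hm.aemeasurable (by fun_prop)]
    refine integral_congr_ae (Eventually.of_forall fun x => ?_)
    simp only [hb, inner_smul_right, EuclideanSpace.inner_single_right]
    simp [mul_assoc]

theorem fourierLaplace_eq_exp_logIntegral (hβ : Measurable β) (hκ : 0 < κ)
    (hβκ : ∀ᵐ v ∂α, κ ≤ (β v : ℝ))
    (hC : ∀ v : unitSphere N, ‖(v : EuclideanSpace ℝ (Fin d))‖ ≤ C)
    (hR : C * R ≤ κ / 2) (hμ : IsMultivariateGamma N α β μ) {ρ : ℝ} (hρR : ρ ≤ R)
    (han : AnalyticOnNhd ℂ (fourierLaplace μ) (Metric.ball 0 ρ))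
    {z : EuclideanSpace ℂ (Fin d)} (hz : ‖z‖ < ρ) :
    fourierLaplace μ z = Complex.exp (logIntegral α β z) := by
  set A := complexVec (reVec z) with hA
  set B := complexVec (imVec z) with hB
  have hline : Continuous fun s : ℂ => A + s • B := by fun_prop
  set D : Set ℂ := (fun s : ℂ => A + s • B) ⁻¹' Metric.ball 0 ρ with hD
  have hDopen : IsOpen D := Metric.isOpen_ball.preimage hline
  have hDconv : Convex ℝ D := by
    intro x hx y hy a b ha hb hab
    have h := convex_ball (0 : EuclideanSpace ℂ (Fin d)) ρ hx hy ha hb hab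
    have e : A + (a • x + b • y) • B = a • (A + x • B) + b • (A + y • B) := by
      have hab' : A = a • A + b • A := by rw [← add_smul, hab, one_smul]
      conv_lhs => rw [hab']
      simp only [smul_add, add_smul, smul_assoc]
      abel
    change A + (a • x + b • y) • B ∈ Metric.ball 0 ρ
    rw [e]
    exact h
  have hf : AnalyticOnNhd ℂ (fun s : ℂ => fourierLaplace μ (A + s • B)) D := by
    have hl : AnalyticOnNhd ℂ (fun s : ℂ => A + s • B) D := fun s _ =>
      analyticAt_const.add (analyticAt_id.smul analyticAt_const)
    exact han.comp hl fun s hs => hs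
  have hg : AnalyticOnNhd ℂ (fun s : ℂ => Complex.exp (logIntegral α β (A + s • B))) D := by
    refine DifferentiableOn.analyticOnNhd (fun s hs => ?_) hDopen
    refine (differentiableAt_logIntegral_line hβ hκ hβκ hC hR A B ?_).cexp.differentiableWithinAt
    exact (norm_imVec_le _).trans_lt ((mem_ball_zero_iff.1 hs).trans_le hρR)
  -- Real parameters give real vectors, where both sides are the characteristic function. They
  -- accumulate at `0`, and the point of interest is `s = i`.
  have hreal : ∀ t : ℝ, fourierLaplace μ (A + (t : ℂ) • B)
      = Complex.exp (logIntegral α β (A + (t : ℂ) • B)) := by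
    intro t
    have e : A + (t : ℂ) • B = complexVec (reVec z + t • imVec z) := by
      ext i
      simp [hA, hB, complexVec]
    rw [e, ← charFun_eq_exp_logIntegral hκ hβκ hμ, ← fourierLaplace_ofReal]
    rfl
  have h0 : (0 : ℂ) ∈ D := by
    change A + (0 : ℂ) • B ∈ Metric.ball 0 ρ
    rw [zero_smul, add_zero, mem_ball_zero_iff, hA, norm_complexVec]
    exact (norm_reVec_le z).trans_lt hz
  have hI : Complex.I ∈ D := by
    change A + Complex.I • B ∈ Metric.ball 0 ρ
    rw [hA, hB, complexVec_reVec_add, mem_ball_zero_iff]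
    exact hz
  have hlim : Tendsto (fun n : ℕ => ((1 / ((n : ℝ) + 1) : ℝ) : ℂ)) atTop (𝓝[≠] 0) := by
    refine tendsto_nhdsWithin_iff.2 ⟨?_, Eventually.of_forall fun n => ?_⟩
    · rw [← Complex.ofReal_zero]
      exact (Complex.continuous_ofReal.tendsto 0).comp tendsto_one_div_add_atTop_nhds_zero_nat
    · have : (0 : ℝ) < 1 / ((n : ℝ) + 1) := by positivity
      exact Complex.ofReal_ne_zero.2 this.ne'
  have hfreq : ∃ᶠ s in 𝓝[≠] (0 : ℂ), fourierLaplace μ (A + s • B)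
      = Complex.exp (logIntegral α β (A + s • B)) :=
    hlim.frequently (Frequently.of_forall fun n => hreal _)
  have h := hf.eqOn_of_preconnected_of_frequently_eq hg hDconv.isPreconnected h0 hfreq hI
  simp only [hA, hB, complexVec_reVec_add] at h
  exact h

end Main

theorem mainTheorem4 {d : ℕ} (N : Seminorm ℝ (EuclideanSpace ℝ (Fin d)))
    (hN : ∀ x, N x = 0 → x = 0)
    (α : Measure (unitSphere N)) [IsFiniteMeasure α]
    (β : unitSphere N → ℝ≥0) (hβ : Measurable β)
    (μ : Measure (EuclideanSpace ℝ (Fin d))) (hμ : IsMultivariateGamma N α β μ) :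
    ((∃ κ : ℝ, 0 < κ ∧ ∀ᵐ v ∂α, κ ≤ (β v : ℝ)) →
      ∃ U : Set (EuclideanSpace ℂ (Fin d)), IsOpen U ∧ 0 ∈ U ∧
        (∀ z ∈ U, FourierLaplaceExistsAt μ z) ∧
        AnalyticOnNhd ℂ (fourierLaplace μ) U ∧
        ∀ z ∈ U,
          (∀ᵐ v : unitSphere N ∂α, gammaQuotient z v (β v) ∈ Complex.slitPlane) ∧
          Integrable (fun v : unitSphere N => Complex.log (gammaQuotient z v (β v))) α ∧
          fourierLaplace μ z = Complex.exp (∫ v : unitSphere N, Complex.log (gammaQuotient z v (β v)) ∂α)) ∧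
    (∀ v : ℕ → unitSphere N,
      Tendsto (fun n => β (v n)) atTop (𝓝 0) → (∀ n, 0 < α {v n}) →
      ∀ U ∈ 𝓝 (0 : EuclideanSpace ℂ (Fin d)), ¬ ∀ z ∈ U, FourierLaplaceExistsAt μ z) := by
  refine ⟨fun ⟨κ, hκ, hβκ⟩ => ?_, fun v hv hα U hU =>
    not_forall_fourierLaplaceExistsAt hβ hμ hv hα hU⟩
  have := hμ.isProbabilityMeasure
  obtain ⟨C, hC0, hC⟩ := exists_norm_le_of_unitSphere hN
  set R := κ / (2 * C) with hRdef
  have hR0 : 0 < R := by positivity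
  have hR : C * R ≤ κ / 2 := le_of_eq (by rw [hRdef]; field_simp)
  -- `R / 2` is the rate of the coordinate moments; `d + 1` is the loss in passing from coordinates
  -- to the norm.
  set ρ := R / 2 / (d + 1) with hρdef
  have hρ : 0 < ρ := by positivity
  have hρR : ρ ≤ R := by
    rw [hρdef, div_le_iff₀ (by positivity)]
    nlinarith [(Nat.cast_nonneg d : (0 : ℝ) ≤ d)]
  have hint : Integrable (fun x => Real.exp (ρ * ‖x‖)) μ :=
    integrable_exp_mul_norm (by positivity) (integrable_cosh_coord hβ hκ hβκ hC hR0 hR hμ)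
  have han := analyticOnNhd_fourierLaplace hρ hint
  refine ⟨Metric.ball 0 ρ, Metric.isOpen_ball, Metric.mem_ball_self hρ,
    fun z hz => fourierLaplaceExistsAt_of_norm_le hint (mem_ball_zero_iff.1 hz).le, han,
    fun z hz => ?_⟩
  have hz' : ‖z‖ < ρ := mem_ball_zero_iff.1 hz
  have him : ‖imVec z‖ ≤ R := (norm_imVec_le z).trans (hz'.le.trans hρR)
  have hq : ∀ᵐ v : unitSphere N ∂α, gammaQuotient z v (β v) ∈ Complex.slitPlane ∧
      Complex.log (gammaQuotient z v (β v)) = -Complex.log (gammaDenom z v (β v)) := by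
    filter_upwards [hβκ, ae_half_le_gammaDenom_re hκ hβκ hC hR him] with v hv hre
    exact log_gammaQuotient (hκ.trans_le hv) hre
  have heq : (fun v : unitSphere N => Complex.log (gammaQuotient z v (β v)))
      =ᵐ[α] fun v => -Complex.log (gammaDenom z v (β v)) := hq.mono fun v h => h.2
  refine ⟨hq.mono fun v h => h.1,
    (integrable_log_gammaDenom hβ hκ hβκ hC hR him).congr heq.symm, ?_⟩
  rw [integral_congr_ae heq]
  exact fourierLaplace_eq_exp_logIntegral hβ hκ hβκ hC hR hμ hρR han hz'
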